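/- Let $D\ge 3$ be an integer and let $G$ be a finite simple graph with maximum degree at most $D$ and no clique on $D+1$ vertices. Then for every integer $c\ge 2$, writing $p=(c^3+8c^2+19c+6)(c+1)$, the graph $G$ has a proper vertex coloring with $D$ colors that is $(c,p)$-nondegenerate, that is, at least $c$ different colors appear among the neighbours of every vertex of degree at least $p$. -/

import Mathlib

/-- A vertex coloring `ξ` of a (locally finite) graph `G` is `(c, p)`-nondegenerate if every vertex
of degree at least `p` has at least `c` different colors among its neighbors. -/
def SimpleGraph.IsNondegenerateColoring {V α : Type*} (G : SimpleGraph V) [G.LocallyFinite]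
    (c p : ℕ) (ξ : V → α) : Prop :=
  ∀ v : V, p ≤ G.degree v → c ≤ (ξ '' G.neighborSet v).ncard

/-!
Let `p = (c ^ 3 + 8 * c ^ 2 + 19 * c + 6) * (c + 1)`. If `D < p`, no vertex has degree `p`, and
Brooks' theorem suffices; it is proved in `exists_properOff_compl` by coloring along paths. So let
`p ≤ D`.

Divide the `D` colors into `c + 2` palettes of nearly equal size. A proper coloring then induces a
partition of the vertices into `c + 2` parts. Choose the coloring so that twice the number of edges
inside the parts, minus twice the sum of the palette sizes over all vertices, is minimal
(`IsMinEnergyColoring`). As long as a vertex has fewer neighbors in a part than the palette of this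
part has colors, it can be moved there. Hence minimality gives the following.
* A vertex has at most as many neighbors in its own part as there are colors in its palette
  (`IsMinEnergyColoring.partDegree_le`). So the vertices of one part may be recolored from their
  palette more or less greedily, which does not change the partition.
* A vertex that sees fewer than `c` parts can move freely to an unseen part. Therefore a vertex `x`
  with `r` such neighbors has at least `r / (c + 2)` *spare* colors, by which the palette exceeds the
  number of neighbors in the same part (`IsMinEnergyColoring.card_add_mul_le`).

A vertex that sees `c` parts sees `c` colors. A vertex `w` of degree at least `p` that sees only
`q < c` parts has a large set `S w` of neighbors in one of these parts, and it suffices to recolor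
this part so that `S w` receives `c + 1 - q` colors. All elements of `S w` have spare colors.
If many of them have at least `c`, then Hall's theorem (`exists_capped_subsets`) selects
`c + 1 - q` of them so that every vertex is selected for few `w`, and the selected vertices can
greedily be given distinct colors (`exists_injOn_recoloring`). Otherwise many have fewer than `c`
spare colors, hence lie in few of the sets `S w`, and Hall's theorem selects pairwise disjoint sets
`P w` of `2 * (c + 1 - q) + 1` such vertices.

The sets `P w` are dealt with in `exists_rainbow_representatives`. Take a coloring of the part with
as many representatives of distinct colors in the sets `P w` as possible, and suppose that some
`P w` has too few. A non-representative `x` in `P w` cannot be recolored to serve as another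
representative. For most colors `j` this means that exactly one neighbor `u` of `x` blocks `j`, and
that every path of *tight* vertices (with as many neighbors as colors) from `u` ends at
representatives only: otherwise the conflict can be pushed along the path
(`exists_recoloring_of_tight_path`). By an exchange of the colors of `x` and `j` one even finds an
edge from the tight vertices to a representative `y` that uses these two colors
(`IsMaxRainbowSystem.exists_edge`). Pushing the conflict to `y` moves the deficiency to the set of
`y`, so the same holds for all sets reached by such exchanges. The edges found for different pairs
`(x, j)` are distinct, but the representatives are too few to supply so many edges.
-/

section NondegenerateColoring

open Finset
open scoped Classical
set_option linter.unusedSectionVars false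

/-! ### Recoloring tools -/

section Recoloring

variable {V C : Type*} [Fintype V] [Fintype C] {H : SimpleGraph V}

/-- `ψ` properly colors the subgraph of `H` induced on the complement of `U`; the vertices of `U`
count as uncolored, whatever value `ψ` takes there. -/
def SimpleGraph.ProperOff (H : SimpleGraph V) (U : Finset V) (ψ : V → C) : Prop :=
  ∀ ⦃u v⦄, H.Adj u v → u ∉ U → v ∉ U → ψ u ≠ ψ v

lemma SimpleGraph.ProperOff.mono {U U' : Finset V} {ψ : V → C} (h : H.ProperOff U ψ)
    (hU : U ⊆ U') : H.ProperOff U' ψ :=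
  fun _ _ huv hu hv => h huv (fun h => hu (hU h)) (fun h => hv (hU h))

lemma exists_color_avoiding (ψ : V → C) (T : Finset V) (hT : #T < Fintype.card C) :
    ∃ k, ∀ u ∈ T, ψ u ≠ k := by
  by_contra! h
  have : (univ : Finset C) ⊆ T.image ψ := fun k _ => by
    obtain ⟨u, hu, rfl⟩ := h k
    exact mem_image_of_mem _ hu
  have h1 := card_le_card this
  have h2 := card_image_le (s := T) (f := ψ)
  rw [card_univ] at h1
  omega

lemma SimpleGraph.ProperOff.update {U : Finset V} {ψ : V → C} (h : H.ProperOff U ψ) {v : V} {k : C}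
    (hk : ∀ u, H.Adj v u → u ∉ U → ψ u ≠ k) :
    H.ProperOff (U.erase v) (Function.update ψ v k) := by
  intro a b hab ha hb
  have hne := hab.ne
  by_cases hav : a = v
  · subst hav
    have hb' : b ∉ U := fun hbU => hb (mem_erase.2 ⟨hne.symm, hbU⟩)
    rw [Function.update_self, Function.update_of_ne hne.symm]
    exact (hk b hab hb').symm
  · have ha' : a ∉ U := fun h => ha (mem_erase.2 ⟨hav, h⟩)
    rw [Function.update_of_ne hav]
    by_cases hbv : b = v
    · subst hbv
      rw [Function.update_self]
      exact hk a hab.symm ha'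
    · rw [Function.update_of_ne hbv]
      exact h hab ha' (fun h => hb (mem_erase.2 ⟨hbv, h⟩))

lemma SimpleGraph.ProperOff.fill {U : Finset V} {ψ : V → C} (h : H.ProperOff U ψ) (v : V)
    (hv : #{u | H.Adj v u ∧ u ∉ U} < Fintype.card C) :
    ∃ k, H.ProperOff (U.erase v) (Function.update ψ v k) := by
  obtain ⟨k, hk⟩ := exists_color_avoiding ψ _ hv
  exact ⟨k, h.update fun u hu huU => hk u (by simp [hu, huU])⟩

lemma card_adj_notMem_le_degree (v : V) (U : Finset V) :
    #{u | H.Adj v u ∧ u ∉ U} ≤ H.degree v := by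
  rw [← H.card_neighborFinset_eq_degree]
  apply card_le_card
  intro u hu
  simp at hu
  simp [hu.1]

/-- Vertices with fewer neighbors than there are colors can be colored greedily. -/
lemma SimpleGraph.ProperOff.fill_finset {U : Finset V} (W : Finset V) :
    ∀ {ψ : V → C}, H.ProperOff (U ∪ W) ψ → (∀ v ∈ W, H.degree v < Fintype.card C) →
    ∃ ψ' : V → C, H.ProperOff U ψ' ∧ ∀ v ∉ W, ψ' v = ψ v := by
  induction W using Finset.induction_on with
  | empty => intro ψ h _; exact ⟨ψ, by simpa using h, fun _ _ => rfl⟩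
  | insert a W ha ih =>
    intro ψ h hW
    obtain ⟨k, hk⟩ := h.fill a
      ((card_adj_notMem_le_degree a _).trans_lt (hW a (mem_insert_self _ _)))
    obtain ⟨ψ', h1, h2⟩ := ih (hk.mono (U' := U ∪ W) (by intro x; simp))
      (fun v hv => hW v (mem_insert_of_mem hv))
    refine ⟨ψ', h1, fun v hv => ?_⟩
    rw [mem_insert, not_or] at hv
    rw [h2 v hv.2, Function.update_of_ne hv.1]

/-- A step from a vertex which has at least as many neighbors as there are colors. -/
def SimpleGraph.TightStep (H : SimpleGraph V) (C : Type*) [Fintype C] (a b : V) : Prop :=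
  H.Adj a b ∧ Fintype.card C ≤ H.degree a

/-- The uncolored vertex can be moved along a path of tight vertices until it reaches a vertex
with fewer neighbors than colors, where it can be colored: as long as the uncolored vertex has no
available color, its neighbors have pairwise distinct colors, and it can take over the color of any
one of them. -/
lemma exists_recoloring_of_tight_path (hdeg : ∀ v, H.degree v ≤ Fintype.card C) {q y : V}
    (hqy : Relation.ReflTransGen (H.TightStep C) q y) (hy : H.degree y < Fintype.card C) :
    ∀ {ψ : V → C}, H.ProperOff {q} ψ → ∃ ψ' : V → C, H.ProperOff ∅ ψ' ∧
      ∀ v, ψ' v ≠ ψ v → Fintype.card C ≤ H.degree v ∨ v = y := by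
  induction hqy using Relation.ReflTransGen.head_induction_on with
  | refl =>
    intro ψ h
    obtain ⟨k, hk⟩ := h.fill y ((card_adj_notMem_le_degree y _).trans_lt hy)
    refine ⟨_, by simpa using hk, fun v hv => Or.inr ?_⟩
    by_contra hne
    exact hv (Function.update_of_ne hne _ _)
  | @head q q' hqq' hq'y ih =>
    intro ψ h
    by_cases hfree : ∃ k, ∀ u, H.Adj q u → u ∉ ({q} : Finset V) → ψ u ≠ k
    · obtain ⟨k, hk⟩ := hfree
      refine ⟨_, by simpa using h.update hk, fun v hv => Or.inl ?_⟩
      by_cases hne : v = q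
      · rw [hne]; exact hqq'.2
      · exact absurd (Function.update_of_ne hne _ _) hv
    · push Not at hfree
      have hinj : Set.InjOn ψ (H.neighborFinset q) := by
        apply card_image_iff.1
        apply le_antisymm card_image_le
        rw [H.card_neighborFinset_eq_degree]
        apply (hdeg q).trans
        rw [← card_univ]
        apply card_le_card
        intro k _
        obtain ⟨u, hu, -, rfl⟩ := hfree k
        exact mem_image_of_mem _ (by simpa using hu)
      have hqne : q ≠ q' := hqq'.1.ne
      have h1 : H.ProperOff {q'} (Function.update ψ q (ψ q')) := by
        have := (h.mono (U' := {q, q'}) (by simp)).update (v := q) (k := ψ q') (by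
          intro u hu huU heq
          have := hinj (by simpa using hu) (by simpa using hqq'.1) heq
          simp [this] at huU)
        rwa [erase_insert (by simpa using hqne)] at this
      obtain ⟨ψ', h2, h3⟩ := ih h1
      refine ⟨ψ', h2, fun v hv => ?_⟩
      by_cases hne : v = q
      · rw [hne]; exact Or.inl hqq'.2
      · apply h3
        rwa [Function.update_of_ne hne]

end Recoloring

/-! ### Brooks' theorem -/

section Brooks

variable {V C : Type*} [Fintype V] [Fintype C] {H : SimpleGraph V}

/-- Along a path of uncolored vertices, all vertices but the last can be colored one after the
other, since each still has its successor as an uncolored neighbor. -/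
lemma SimpleGraph.ProperOff.fill_path (hdeg : ∀ v, H.degree v ≤ Fintype.card C) (t : V) :
    ∀ (l : List V) {U : Finset V} {ψ : V → C}, H.ProperOff U ψ → (l ++ [t]).IsChain H.Adj →
      (l ++ [t]).Nodup → (∀ v ∈ l ++ [t], v ∈ U) →
      ∃ ψ' : V → C, H.ProperOff (U \ l.toFinset) ψ' ∧ ∀ v ∉ l, ψ' v = ψ v
  | [], U, ψ, h, _, _, _ => ⟨ψ, by simpa using h, fun _ _ => rfl⟩
  | a :: l, U, ψ, h, hch, hnd, hU => by
    obtain ⟨b, hb, hab⟩ : ∃ b ∈ l ++ [t], H.Adj a b := by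
      cases l with
      | nil => exact ⟨t, by simp, by simpa using hch⟩
      | cons b l => exact ⟨b, by simp, by simp at hch; exact hch.1⟩
    rw [List.cons_append] at hch hnd hU
    have hbU : b ∈ U := hU b (List.mem_cons_of_mem _ hb)
    have hlt : #{u | H.Adj a u ∧ u ∉ U} < Fintype.card C := by
      refine lt_of_lt_of_le ?_ (hdeg a)
      rw [← H.card_neighborFinset_eq_degree]
      apply card_lt_card
      refine ⟨fun u hu => by simp at hu; simp [hu.1], fun hcon => ?_⟩
      have := hcon (by simpa using hab : b ∈ H.neighborFinset a)
      simp [hbU] at this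
    obtain ⟨k, hk⟩ := h.fill a hlt
    have hal : a ∉ l ++ [t] := (List.nodup_cons.1 hnd).1
    obtain ⟨ψ', h1, h2⟩ := SimpleGraph.ProperOff.fill_path hdeg t l hk hch.tail
      (List.nodup_cons.1 hnd).2 (fun v hv => mem_erase.2
        ⟨fun hva => hal (hva ▸ hv), hU v (List.mem_cons_of_mem _ hv)⟩)
    refine ⟨ψ', h1.mono (fun v => by simp; tauto), fun v hv => ?_⟩
    rw [List.mem_cons, not_or] at hv
    rw [h2 v hv.2, Function.update_of_ne hv.1]

/-- A vertex with two neighbors of the same color can be colored. -/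
lemma SimpleGraph.ProperOff.fill_of_eq {U : Finset V} {ψ : V → C} (h : H.ProperOff U ψ) {v w x : V}
    (hdeg : H.degree v ≤ Fintype.card C) (hw : H.Adj v w) (hx : H.Adj v x) (hwx : w ≠ x)
    (heq : ψ w = ψ x) : ∃ k, H.ProperOff (U.erase v) (Function.update ψ v k) := by
  have hwN : w ∈ H.neighborFinset v := by simpa using hw
  obtain ⟨k, hk⟩ := exists_color_avoiding ψ ((H.neighborFinset v).erase w) (by
    refine lt_of_lt_of_le ?_ hdeg
    rw [← H.card_neighborFinset_eq_degree]
    exact card_lt_card (erase_ssubset hwN))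
  refine ⟨k, h.update fun u hu _ => ?_⟩
  by_cases huw : u = w
  · rw [huw, heq]
    exact hk x (by simp [hwx.symm, hx])
  · exact hk u (by simp [huw, hu])

lemma List.exists_eq_append_cons_of_last {α : Type*} (p : α → Prop) (l : List α)
    (h : ∃ x ∈ l, p x) : ∃ s t r, l = s ++ t :: r ∧ p t ∧ ∀ x ∈ r, ¬ p x := by
  induction l with
  | nil => simp at h
  | cons a l ih =>
    by_cases hl : ∃ x ∈ l, p x
    · obtain ⟨s, t, r, h1, h2, h3⟩ := ih hl
      exact ⟨a :: s, t, r, by simp [h1], h2, h3⟩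
    · push Not at hl
      obtain ⟨x, hx, hpx⟩ := h
      rcases List.mem_cons.1 hx with rfl | hx
      · exact ⟨[], x, l, rfl, hpx, hl⟩
      · exact absurd hpx (hl x hx)

lemma List.exists_eq_append_cons_of_first {α : Type*} (p : α → Prop) (l : List α)
    (h : ∃ x ∈ l, p x) : ∃ s t r, l = s ++ t :: r ∧ p t ∧ ∀ x ∈ s, ¬ p x := by
  obtain ⟨s, t, r, h1, h2, h3⟩ :=
    List.exists_eq_append_cons_of_last p l.reverse (by simpa using h)
  refine ⟨r.reverse, t, s.reverse, ?_, h2, by simpa using h3⟩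
  rw [← List.reverse_reverse l, h1]
  simp

/-- If `S` is covered by a path ending with `v₃, v₂, v₁`, where `v₁` and `v₃` are not adjacent, and
`v₂` has enough neighbors in `S`, then `S` can be colored: give `v₁` and `v₃` the same color, and
then color along paths towards a third neighbor of `v₂` and finally `v₂` itself. -/
lemma exists_properOff_of_hamiltonian_path (hdeg : ∀ v, H.degree v ≤ Fintype.card C)
    (hC : 3 ≤ Fintype.card C) {S : Finset V} {m : List V} {v₁ v₂ v₃ : V}
    (hch : (m ++ [v₃, v₂, v₁]).IsChain H.Adj) (hnd : (m ++ [v₃, v₂, v₁]).Nodup)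
    (hS : ∀ v ∈ S, v ∈ m ++ [v₃, v₂, v₁]) (hnadj : ¬ H.Adj v₁ v₃)
    (hv₂ : Fintype.card C ≤ #{u ∈ S | H.Adj v₂ u}) :
    ∃ ψ : V → C, H.ProperOff Sᶜ ψ := by
  obtain ⟨u, huS, hu⟩ : ∃ u ∈ ({u ∈ S | H.Adj v₂ u} : Finset V), u ∉ ({v₁, v₃} : Finset V) := by
    apply exists_mem_notMem_of_card_lt_card
    have := card_le_two (a := v₁) (b := v₃)
    omega
  simp only [mem_filter, mem_insert, mem_singleton, not_or] at huS hu
  have hum : u ∈ m := by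
    have := hS u huS.1
    simp only [List.mem_append, List.mem_cons, List.not_mem_nil, or_false] at this
    have := huS.2.ne
    grind
  obtain ⟨m₁, m₂, rfl⟩ := List.append_of_mem hum
  obtain ⟨k₀⟩ : Nonempty C := Fintype.card_pos_iff.1 (by omega)
  have h21 : H.Adj v₂ v₁ := by
    have := (List.isChain_append.1 hch).2.1
    simp at this
    exact this.2
  have h32 : H.Adj v₃ v₂ := by
    have := (List.isChain_append.1 hch).2.1
    simp at this
    exact this.1
  have h0 : H.ProperOff ({v₁, v₃} : Finset V)ᶜ (fun _ => k₀) := by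
    intro a b hab ha hb
    simp only [mem_compl, not_not, mem_insert, mem_singleton] at ha hb
    rcases ha with rfl | rfl <;> rcases hb with rfl | rfl
    · exact absurd hab (H.loopless.irrefl _)
    · exact absurd hab hnadj
    · exact absurd hab.symm hnadj
    · exact absurd hab (H.loopless.irrefl _)
  have hnd' := hnd
  simp only [List.nodup_append, List.nodup_cons, List.mem_cons, List.mem_append] at hnd'
  obtain ⟨ψ₁, h1, h1'⟩ := h0.fill_path hdeg u m₂.reverse
    (by
      have : (u :: m₂).IsChain H.Adj := by
        have := (List.isChain_append.1 hch).1
        exact (List.isChain_append.1 this).2.1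
      have h2 := List.isChain_reverse.2 (this.imp fun _ _ h => h.symm)
      simpa using h2)
    (by
      have : (u :: m₂).Nodup := by simp; grind
      simpa using List.nodup_reverse.2 this)
    (by simp only [List.mem_append, List.mem_reverse, List.mem_singleton, mem_compl, mem_insert,
          mem_singleton]
        grind)
  obtain ⟨ψ₂, h2, h2'⟩ := h1.fill_path hdeg v₂ (m₁ ++ [u])
    (by
      have : (m₁ ++ [u]).IsChain H.Adj := by
        have := (List.isChain_append.1 hch).1
        rw [List.append_cons] at this
        exact (List.isChain_append.1 this).1
      rw [List.isChain_append]
      refine ⟨this, by simp, ?_⟩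
      simpa using huS.2.symm)
    (by simp [List.nodup_append]; grind)
    (by simp only [List.mem_append, List.mem_singleton, mem_compl, mem_insert,
          mem_singleton, mem_sdiff, List.mem_toFinset, List.mem_reverse]
        grind)
  have e1 : ψ₂ v₁ = k₀ := by
    rw [h2' v₁ (by simp; grind), h1' v₁ (by simp; grind)]
  have e3 : ψ₂ v₃ = k₀ := by
    rw [h2' v₃ (by simp; grind), h1' v₃ (by simp; grind)]
  obtain ⟨k, hk⟩ := h2.fill_of_eq (hdeg v₂) h21 h32.symm (by grind) (e1.trans e3.symm)
  refine ⟨_, hk.mono fun v hv => ?_⟩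
  simp only [mem_erase, mem_sdiff, mem_compl, mem_insert, mem_singleton, List.mem_toFinset,
    List.mem_append, List.mem_reverse, List.mem_singleton, not_or] at hv
  rw [mem_compl]
  intro hvS
  have := hS v hvS
  simp only [List.mem_append, List.mem_cons, List.not_mem_nil, or_false] at this
  grind

/-- A coloring of the rest of the graph extends to a cycle, given as a list whose last element is
adjacent to the first, if a vertex of the cycle has a neighbor outside the cycle while its
predecessor has none. -/
lemma exists_properOff_of_cycle (hdeg : ∀ v, H.degree v ≤ Fintype.card C) {S : Finset V}
    {B A : List V} {w v x a t : V} (ha : (B ++ [w]).head? = some a)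
    (ht : (v :: A).getLast? = some t) (hat : H.Adj a t)
    (hch : (B ++ [w] ++ v :: A).IsChain H.Adj) (hnd : (B ++ [w] ++ v :: A).Nodup)
    (hw : ∀ u, H.Adj w u → u ∈ B ++ [w] ++ v :: A) (hvx : H.Adj v x)
    (hx : x ∉ B ++ [w] ++ v :: A) {ψ : V → C}
    (hψ : H.ProperOff (S \ (B ++ [w] ++ v :: A).toFinset)ᶜ ψ) :
    ∃ ψ : V → C, H.ProperOff Sᶜ ψ := by
  set Z := B ++ [w] ++ v :: A with hZ
  have hmem : ∀ u, u ∈ Z ↔ u ∈ B ∨ u = w ∨ u = v ∨ u ∈ A := by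
    intro u; simp [hZ]
  have h0 := hψ.update (v := w) (k := ψ x) (fun u hu huU => by
    simp only [mem_compl, mem_sdiff, List.mem_toFinset, not_not] at huU
    exact absurd (hw u hu) huU.2)
  have hwv : H.Adj w v := by
    have := (List.isChain_append.1 hch).2.2
    exact this w (by simp) v (by simp)
  have hxw : x ≠ w := fun h => hx ((hmem x).2 (by simp [h]))
  simp only [hZ, List.nodup_append, List.nodup_cons, List.mem_cons, List.mem_append] at hnd
  -- the cycle without `w`, read from `w` backwards to `v`
  have hpath : (v :: A ++ B).reverse = (A ++ B).reverse ++ [v] := by simp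
  obtain ⟨ψ₁, h1, h1'⟩ := h0.fill_path hdeg v (A ++ B).reverse
    (by
      rw [← hpath, List.isChain_reverse, List.isChain_append]
      refine ⟨?_, ?_, ?_⟩
      · exact (List.isChain_append.1 hch).2.1.imp fun _ _ h => h.symm
      · exact (List.isChain_append.1 (List.isChain_append.1 hch).1).1.imp fun _ _ h => h.symm
      · intro p hp q hq
        rw [ht] at hp
        cases B with
        | nil => simp at hq
        | cons b B =>
          simp at ha hp hq
          subst ha hp hq
          exact hat)
    (by
      rw [← hpath, List.nodup_reverse]
      simp [List.nodup_append]
      grind)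
    (by
      intro u hu
      rw [← hpath] at hu
      simp only [List.mem_reverse, List.mem_append, List.mem_cons] at hu
      rw [mem_erase, mem_compl, mem_sdiff, List.mem_toFinset, hmem]
      grind)
  have e1 : ψ₁ w = ψ x := by
    rw [h1' w (by simp; grind), Function.update_self]
  have e2 : ψ₁ x = ψ x := by
    rw [h1' x (by rw [hmem] at hx; simp; grind), Function.update_of_ne hxw]
  obtain ⟨k, hk⟩ := h1.fill_of_eq (hdeg v) hwv.symm hvx hxw.symm (e1.trans e2.symm)
  refine ⟨_, hk.mono fun u hu => ?_⟩
  simp only [mem_erase, mem_sdiff, mem_compl, List.mem_toFinset, List.mem_reverse,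
    List.mem_append, not_or, hmem] at hu ⊢
  grind

/-- **Brooks' theorem**, for the subgraph induced on a set `S` of vertices. -/
lemma exists_properOff_compl (hdeg : ∀ v, H.degree v ≤ Fintype.card C)
    (hC : 3 ≤ Fintype.card C) (hclique : H.CliqueFree (Fintype.card C + 1)) (S : Finset V) :
    ∃ ψ : V → C, H.ProperOff Sᶜ ψ := by
  induction S using Finset.strongInduction with
  | H S ih =>
  obtain ⟨k₀⟩ : Nonempty C := Fintype.card_pos_iff.1 (by omega)
  by_cases hlow : ∃ v ∈ S, #{u ∈ S | H.Adj v u} < Fintype.card C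
  · obtain ⟨v, hvS, hv⟩ := hlow
    obtain ⟨ψ, hψ⟩ := ih _ (erase_ssubset hvS)
    obtain ⟨k, hk⟩ := hψ.fill v (lt_of_le_of_lt (card_le_card fun u hu => by
      simp at hu
      simp [hu]) hv)
    exact ⟨_, hk.mono fun u hu => by simp at hu ⊢; tauto⟩
  push Not at hlow
  rcases S.eq_empty_or_nonempty with rfl | ⟨v₂, hv₂⟩
  · exact ⟨fun _ => k₀, fun u v _ hu => by simp at hu⟩
  have hN : ∀ v ∈ S, ({u ∈ S | H.Adj v u} : Finset V) = H.neighborFinset v := by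
    intro v hv
    apply eq_of_subset_of_card_le
    · intro u hu; simp at hu; simpa using hu.2
    · rw [H.card_neighborFinset_eq_degree]; exact (hdeg v).trans (hlow v hv)
  have hclosed : ∀ v ∈ S, ∀ u, H.Adj v u → u ∈ S := by
    intro v hv u hu
    have : u ∈ ({u ∈ S | H.Adj v u} : Finset V) := by rw [hN v hv]; simpa using hu
    exact (mem_filter.1 this).1
  obtain ⟨v₁, v₃, h21, h23, h13, hnadj⟩ : ∃ v₁ v₃, H.Adj v₂ v₁ ∧ H.Adj v₂ v₃ ∧ v₁ ≠ v₃ ∧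
      ¬ H.Adj v₁ v₃ := by
    by_contra! hcon
    apply hclique (insert v₂ (H.neighborFinset v₂))
    constructor
    · rw [coe_insert, SimpleGraph.isClique_insert]
      refine ⟨fun a ha b hb hab => hcon a b (by simpa using ha) (by simpa using hb) hab,
        fun b hb _ => by simpa using hb⟩
    · rw [card_insert_of_notMem (by simp), ← hN v₂ hv₂]
      have h1 := hlow v₂ hv₂
      have h2 := hdeg v₂
      rw [← H.card_neighborFinset_eq_degree, ← hN v₂ hv₂] at h2
      omega
  let Q : Set (List V) := {m | (m ++ [v₃, v₂, v₁]).IsChain H.Adj ∧ (m ++ [v₃, v₂, v₁]).Nodup ∧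
    ∀ v ∈ m ++ [v₃, v₂, v₁], v ∈ S}
  have hQfin : Q.Finite :=
    (List.finite_length_le V (Fintype.card V)).subset fun m hm =>
      (List.nodup_append.1 hm.2.1).1.length_le_card
  have hQne : Q.Nonempty := by
    refine ⟨[], ?_, ?_, ?_⟩
    · simp [h21, h23.symm]
    · simp [h21.ne, h23.ne.symm, h13.symm]
    · simp [hv₂, hclosed v₂ hv₂ v₁ h21, hclosed v₂ hv₂ v₃ h23]
  obtain ⟨m, ⟨hch, hnd, hmS⟩, hmax⟩ := hQfin.exists_maximalFor List.length Q hQne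
  obtain ⟨a, l, hal⟩ : ∃ a l, m ++ [v₃, v₂, v₁] = a :: l := by
    cases m with
    | nil => exact ⟨_, _, rfl⟩
    | cons b m => exact ⟨_, _, rfl⟩
  have haS : a ∈ S := hmS a (by simp [hal])
  have hanbr : ∀ u, H.Adj a u → u ∈ l := by
    intro u hu
    by_contra hul
    have hmem : u ∉ m ++ [v₃, v₂, v₁] := by
      rw [hal]; simp [hul, hu.ne.symm]
    have : u :: m ∈ Q := by
      refine ⟨?_, ?_, ?_⟩
      · rw [List.cons_append, hal, List.isChain_cons_cons]
        exact ⟨hu.symm, hal ▸ hch⟩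
      · rw [List.cons_append, List.nodup_cons]
        exact ⟨hmem, hnd⟩
      · intro v hv
        rw [List.cons_append, List.mem_cons] at hv
        rcases hv with rfl | hv
        · exact hclosed a haS _ hu
        · exact hmS v hv
    have := hmax this (by simp)
    simp at this
  have hadeg : 0 < #(H.neighborFinset a) := by
    rw [← hN a haS]; have := hlow a haS; omega
  obtain ⟨u₀, hu₀⟩ := card_pos.1 hadeg
  have hu₀ : H.Adj a u₀ := by simpa using hu₀
  obtain ⟨s, t, r, hl, hat, hr⟩ := List.exists_eq_append_cons_of_last (H.Adj a) l
    ⟨u₀, hanbr u₀ hu₀, hu₀⟩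
  set Z : List V := a :: (s ++ [t]) with hZ
  have hZl : m ++ [v₃, v₂, v₁] = Z ++ r := by rw [hal, hl, hZ]; simp
  have hZch : Z.IsChain H.Adj := by rw [hZl] at hch; exact (List.isChain_append.1 hch).1
  have hZnd : Z.Nodup := by rw [hZl] at hnd; exact (List.nodup_append.1 hnd).1
  have hZS : Z.toFinset ⊆ S := fun v hv =>
    hmS v (by rw [hZl]; exact List.mem_append_left _ (List.mem_toFinset.1 hv))
  have hZt : Z.getLast? = some t := by
    rw [hZ, ← List.cons_append, List.getLast?_concat]
  have haZ : ∀ u, H.Adj a u → u ∈ Z := by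
    intro u hu
    have h1 := hanbr u hu
    rw [hl] at h1
    have h2 : u ∉ r := fun h => hr u h hu
    simp only [List.mem_append, List.mem_cons] at h1
    simp [hZ]
    tauto
  by_cases hout : ∃ v ∈ Z, ∃ x, H.Adj v x ∧ x ∉ Z
  · obtain ⟨B, v, A, hZB, ⟨x, hvx, hxZ⟩, hB⟩ :=
      List.exists_eq_append_cons_of_first (fun v => ∃ x, H.Adj v x ∧ x ∉ Z) Z hout
    have hBne : B ≠ [] := by
      rintro rfl
      rw [List.nil_append, hZ, List.cons.injEq] at hZB
      rw [← hZB.1] at hvx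
      exact hxZ (haZ x hvx)
    obtain ⟨B, w, rfl⟩ := List.eq_nil_or_concat'  B |>.resolve_left hBne
    obtain ⟨ψ, hψ⟩ := ih (S \ Z.toFinset)
      (sdiff_ssubset hZS ⟨a, by simp [hZ]⟩)
    have ha : (B ++ [w]).head? = some a := by
      have : (B ++ [w] ++ v :: A).head? = some a := by rw [← hZB, hZ]; rfl
      rwa [List.head?_append_of_ne_nil _ hBne] at this
    rw [hZB] at hZt hZch hZnd hxZ hψ hB
    refine exists_properOff_of_cycle hdeg ha (by simpa using hZt) hat hZch hZnd ?_ hvx hxZ hψ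
    intro u hu
    by_contra hcon
    exact hB w (by simp) ⟨u, hu, hcon⟩
  · push Not at hout
    by_cases hSZ : S = Z.toFinset
    · refine exists_properOff_of_hamiltonian_path hdeg hC hch hnd (fun v hv => ?_) hnadj
        (hlow v₂ hv₂)
      rw [hSZ] at hv
      rw [hZl]
      exact List.mem_append_left _ (List.mem_toFinset.1 hv)
    · obtain ⟨ψ₁, h1⟩ := ih Z.toFinset (lt_of_le_of_ne hZS (Ne.symm hSZ))
      obtain ⟨ψ₂, h2⟩ := ih (S \ Z.toFinset) (sdiff_ssubset hZS ⟨a, by simp [hZ]⟩)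
      refine ⟨fun v => if v ∈ Z then ψ₁ v else ψ₂ v, fun u v huv hu hv => ?_⟩
      rw [mem_compl, not_not] at hu hv
      by_cases huZ : u ∈ Z
      · have hvZ := hout u huZ v huv
        simp only [huZ, hvZ, if_true]
        exact h1 huv (by simpa using huZ) (by simpa using hvZ)
      · have hvZ : v ∉ Z := fun h => huZ (hout v h u huv.symm)
        simp only [huZ, hvZ, if_false]
        exact h2 huv (by simp [hu, huZ]) (by simp [hv, hvZ])

end Brooks

/-! ### Rainbow systems: local changes to a maximal system -/

section RainbowSystem

variable {V C ι : Type*} [Fintype V] [Fintype C] [Fintype ι] {H : SimpleGraph V}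
  {P : ι → Finset V} {e : ι → ℕ}

/-- A proper coloring `ψ` of `H` together with sets `R w ⊆ P w` of at most `e w` vertices each, on
each of which `ψ` is injective. -/
structure IsRainbowSystem (H : SimpleGraph V) (P : ι → Finset V) (e : ι → ℕ) (ψ : V → C)
    (R : ι → Finset V) : Prop where
  proper : H.ProperOff ∅ ψ
  subset : ∀ w, R w ⊆ P w
  injOn : ∀ w, Set.InjOn ψ (R w)
  card_le : ∀ w, #(R w) ≤ e w

/-- A rainbow system with the largest possible total number of representatives. -/
structure IsMaxRainbowSystem (H : SimpleGraph V) (P : ι → Finset V) (e : ι → ℕ) (ψ : V → C)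
    (R : ι → Finset V) : Prop extends IsRainbowSystem H P e ψ R where
  max : ∀ (ψ' : V → C) R', IsRainbowSystem H P e ψ' R' → ∑ w, #(R' w) ≤ ∑ w, #(R w)

/-- The neighbors of `x` of color `j` that resist being uncolored and recolored greedily: those
which are representatives or have at least as many neighbors as there are colors. -/
noncomputable def blockers (H : SimpleGraph V) (ψ : V → C) (R : ι → Finset V) (x : V) (j : C) :
    Finset V :=
  {v | H.Adj x v ∧ ψ v = j ∧ ((∃ w, v ∈ R w) ∨ Fintype.card C ≤ H.degree v)}

/-- The neighbors of `x` from which a free vertex other than `x` can be reached by tight steps,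
where a vertex is free if it is no representative and has fewer neighbors than there are colors. -/
noncomputable def liveNeighbors (H : SimpleGraph V) (C : Type*) [Fintype C] (R : ι → Finset V)
    (x : V) : Finset V :=
  {v | H.Adj x v ∧ ∃ s, s ≠ x ∧ (∀ w, s ∉ R w) ∧ H.degree s < Fintype.card C ∧
    Relation.ReflTransGen (H.TightStep C) v s}

lemma reflTransGen_tightStep_symm {a z : V} (h : Relation.ReflTransGen (H.TightStep C) a z)
    (hz : Fintype.card C ≤ H.degree z) :
    Fintype.card C ≤ H.degree a ∧ Relation.ReflTransGen (H.TightStep C) z a := by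
  induction h using Relation.ReflTransGen.head_induction_on with
  | refl => exact ⟨hz, .refl⟩
  | head h _ ih => exact ⟨h.2, ih.2.tail ⟨h.1.symm, ih.1⟩⟩

namespace IsMaxRainbowSystem

variable {ψ : V → C} {R : ι → Finset V} (hmax : IsMaxRainbowSystem H P e ψ R)
include hmax

/-- In a maximal system no vertex can be added to a deficient set `R w` by a recoloring that fixes
all representatives. -/
lemma false_of_recoloring {w : ι} (hw : #(R w) < e w) {x : V} (hx : x ∈ P w) (hxR : x ∉ R w)
    {ψ' : V → C} (hψ' : H.ProperOff ∅ ψ') (hfix : ∀ w, ∀ v ∈ R w, ψ' v = ψ v)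
    (hnew : ∀ r ∈ R w, ψ r ≠ ψ' x) : False := by
  have key : IsRainbowSystem H P e ψ' (Function.update R w (insert x (R w))) := by
    refine ⟨hψ', fun a => ?_, fun a => ?_, fun a => ?_⟩ <;> by_cases ha : a = w
    · subst ha
      rw [Function.update_self]
      exact insert_subset hx (hmax.subset a)
    · rw [Function.update_of_ne ha]; exact hmax.subset a
    · subst ha
      rw [Function.update_self, coe_insert, Set.injOn_insert (by simpa using hxR)]
      refine ⟨fun u hu v hv huv => hmax.injOn a hu hv ?_, ?_⟩
      · rwa [← hfix a u hu, ← hfix a v hv]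
      · rintro ⟨r, hr, hrx⟩
        exact hnew r hr (by rw [← hfix a r hr, hrx])
    · rw [Function.update_of_ne ha]
      intro u hu v hv huv
      exact hmax.injOn a hu hv (by rwa [← hfix a u hu, ← hfix a v hv])
    · subst ha
      rw [Function.update_self, card_insert_of_notMem hxR]
      exact hw
    · rw [Function.update_of_ne ha]; exact hmax.card_le a
  have h1 := hmax.max _ _ key
  have h2 : ∑ a, #(R a) < ∑ a, #(Function.update R w (insert x (R w)) a) := by
    apply sum_lt_sum
    · intro a _
      by_cases ha : a = w
      · subst ha; rw [Function.update_self]; exact card_le_card (subset_insert _ _)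
      · rw [Function.update_of_ne ha]
    · refine ⟨w, mem_univ _, ?_⟩
      rw [Function.update_self, card_insert_of_notMem hxR]
      omega
  omega

variable (hdeg : ∀ v, H.degree v ≤ Fintype.card C)
  (hlow : ∀ w, ∀ v ∈ P w, H.degree v < Fintype.card C)
  (hdisj : ∀ w w', ∀ v, v ∈ P w → v ∈ P w' → w = w')
  {w : ι} (hw : #(R w) < e w) {x : V} (hx : x ∈ P w) (hxR : x ∉ R w)
  {j : C} (hj : j ≠ ψ x) (hjR : ∀ r ∈ R w, ψ r ≠ j)

include hdisj hx hxR in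
omit hmax in
lemma notMem_of_subset (hsub : ∀ w, R w ⊆ P w) (a : ι) : x ∉ R a := fun h => by
  have := hdisj _ _ _ hx (hsub a h)
  exact hxR (this ▸ h)

include hj in
/-- Recoloring `x` with `j` creates conflicts only at the neighbors of `x` of color `j`. -/
lemma properOff_update :
    H.ProperOff {v | H.Adj x v ∧ ψ v = j} (Function.update ψ x j) := by
  have := (hmax.proper.mono (U' := insert x ({v | H.Adj x v ∧ ψ v = j} : Finset V))
    (by simp)).update (v := x) (k := j) (by
      intro u hu huU heq
      simp [hu, heq] at huU)
  rwa [erase_insert (by simp)] at this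

include hlow hdisj hw hx hxR hj hjR in
lemma blockers_nonempty : (blockers H ψ R x j).Nonempty := by
  by_contra hne
  rw [not_nonempty_iff_eq_empty] at hne
  have hB : ∀ v, H.Adj x v → ψ v = j → (∀ w, v ∉ R w) ∧ H.degree v < Fintype.card C := by
    intro v hv hvj
    by_contra hcon
    have : v ∈ blockers H ψ R x j := by
      simp only [blockers, mem_filter, mem_univ, true_and]
      refine ⟨hv, hvj, ?_⟩
      by_contra h2
      push Not at h2
      exact hcon h2
    simp [hne] at this
  obtain ⟨ψ', h1, h2⟩ := SimpleGraph.ProperOff.fill_finset (U := ∅) _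
    (by simpa using hmax.properOff_update hj)
    (fun v hv => by simp at hv; exact (hB v hv.1 hv.2).2)
  have hxj : ψ' x = j := by rw [h2 x (by simp), Function.update_self]
  refine hmax.false_of_recoloring hw hx hxR h1 (fun a v hv => ?_) (by rwa [hxj])
  have hvx : v ≠ x := by
    rintro rfl
    exact notMem_of_subset hdisj hx hxR hmax.subset a hv
  rw [h2, Function.update_of_ne hvx]
  intro hcon
  simp at hcon
  exact (hB v hcon.1 hcon.2).1 a hv

include hdeg hlow hdisj hx hxR hj in
/-- If `u` is the only blocker of `x` for the color `j`, then `x` can be recolored with `j` by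
pushing the conflict from `u` along tight vertices to `y`. -/
lemma exists_push {u y : V} (hu : blockers H ψ R x j = {u})
    (huy : Relation.ReflTransGen (H.TightStep C) u y) (hy : H.degree y < Fintype.card C)
    (hyx : y ≠ x) :
    ∃ ψ' : V → C, H.ProperOff ∅ ψ' ∧ ψ' x = j ∧ ∀ w, ∀ v ∈ R w, v ≠ y → ψ' v = ψ v := by
  set U : Finset V := {v | H.Adj x v ∧ ψ v = j} with hU
  have huU : u ∈ blockers H ψ R x j := by simp [hu]
  have hB : ∀ v ∈ U.erase u, (∀ w, v ∉ R w) ∧ H.degree v < Fintype.card C := by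
    intro v hv
    rw [mem_erase] at hv
    simp only [hU, mem_filter, mem_univ, true_and] at hv
    by_contra hcon
    have : v ∈ blockers H ψ R x j := by
      simp only [blockers, mem_filter, mem_univ, true_and]
      refine ⟨hv.2.1, hv.2.2, ?_⟩
      by_contra h2
      push Not at h2
      exact hcon h2
    rw [hu, mem_singleton] at this
    exact hv.1 this
  obtain ⟨ψ₁, h1, h2⟩ := SimpleGraph.ProperOff.fill_finset (U := {u}) (U.erase u)
    ((hmax.properOff_update hj).mono (by
      intro v hv
      by_cases hvu : v = u
      · simp [hvu]
      · simp only [mem_union, mem_erase]; exact Or.inr ⟨hvu, hv⟩))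
    (fun v hv => (hB v hv).2)
  obtain ⟨ψ₂, h3, h4⟩ := exists_recoloring_of_tight_path hdeg huy hy h1
  have hkeep : ∀ v, H.degree v < Fintype.card C → v ≠ y → ψ₂ v = ψ₁ v := by
    intro v hv hvy
    by_contra hcon
    rcases h4 v hcon with h | h
    · omega
    · exact hvy h
  refine ⟨ψ₂, h3, ?_, fun a v hv hvy => ?_⟩
  · rw [hkeep x (hlow _ _ hx) hyx.symm, h2 x (by simp [hU]), Function.update_self]
  · have hvx : v ≠ x := by
      rintro rfl
      exact notMem_of_subset hdisj hx hxR hmax.subset a hv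
    rw [hkeep v (hlow a v (hmax.subset a hv)) hvy, h2, Function.update_of_ne hvx]
    exact fun hcon => (hB v hcon).1 a hv

include hdeg hlow hdisj hw hx hxR hj hjR in
lemma mem_of_reachable {u y : V} (hu : blockers H ψ R x j = {u})
    (huy : Relation.ReflTransGen (H.TightStep C) u y) (hy : H.degree y < Fintype.card C)
    (hyx : y ≠ x) : ∃ a, y ∈ R a := by
  by_contra! hcon
  obtain ⟨ψ', h1, h2, h3⟩ := hmax.exists_push hdeg hlow hdisj hx hxR hj hu huy hy hyx
  refine hmax.false_of_recoloring hw hx hxR h1 (fun a v hv => h3 a v hv ?_) (by rwa [h2])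
  rintro rfl
  exact hcon a hv

include hdeg hlow hdisj hw hx hxR hj hjR in
/-- The deficiency can be moved from `w` to `w'`: the vertex `x` becomes a representative for `w`,
at the expense of a representative `y` for `w'`. -/
lemma exists_exchange {u y : V} (hu : blockers H ψ R x j = {u})
    (huy : Relation.ReflTransGen (H.TightStep C) u y) {w' : ι} (hw' : w' ≠ w) (hy : y ∈ R w') :
    ∃ (ψ' : V → C) (R' : ι → Finset V), IsMaxRainbowSystem H P e ψ' R' ∧ #(R' w') < e w' ∧
      ∀ a, ∀ v ∈ R' a, v = x ∨ ∃ b, v ∈ R b := by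
  have hyx : y ≠ x := by
    rintro rfl
    exact notMem_of_subset hdisj hx hxR hmax.subset _ hy
  obtain ⟨ψ', h1, h2, h3⟩ := hmax.exists_push hdeg hlow hdisj hx hxR hj hu huy
    (hlow _ _ (hmax.subset _ hy)) hyx
  set R' : ι → Finset V :=
    fun a => if a = w then insert x (R w) else (R a).erase y with hR'
  have hyw : ∀ a, a ≠ w' → y ∉ R a := fun a ha hya =>
    ha (hdisj _ _ _ (hmax.subset _ hya) (hmax.subset _ hy))
  have hRw : R' w = insert x (R w) := by simp [hR']
  have hR'a : ∀ a, a ≠ w → R' a = (R a).erase y := fun a ha => by simp [hR', ha]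
  have hcardw' : #(R' w') + 1 = #(R w') := by
    rw [hR'a w' hw', card_erase_add_one hy]
  have hstate : IsRainbowSystem H P e ψ' R' := by
    refine ⟨h1, fun a => ?_, fun a => ?_, fun a => ?_⟩ <;> by_cases ha : a = w
    · rw [ha, hRw]; exact insert_subset hx (hmax.subset w)
    · rw [hR'a a ha]; exact (erase_subset _ _).trans (hmax.subset a)
    · rw [ha, hRw, coe_insert, Set.injOn_insert (by simpa using hxR)]
      have hk : ∀ r ∈ R w, ψ' r = ψ r := fun r hr =>
        h3 w r hr (fun h => hyw w hw'.symm (h ▸ hr))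
      refine ⟨fun u hu v hv huv => hmax.injOn w hu hv ?_, ?_⟩
      · rwa [← hk u hu, ← hk v hv]
      · rintro ⟨r, hr, hrx⟩
        exact hjR r hr (by rw [← hk r hr, hrx, h2])
    · rw [hR'a a ha]
      intro u hu v hv huv
      rw [mem_coe, mem_erase] at hu hv
      exact hmax.injOn a hu.2 hv.2 (by rwa [← h3 a u hu.2 hu.1, ← h3 a v hv.2 hv.1])
    · rw [ha, hRw, card_insert_of_notMem hxR]; exact hw
    · rw [hR'a a ha]; exact (card_le_card (erase_subset _ _)).trans (hmax.card_le a)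
  have hsum : ∑ a, #(R' a) = ∑ a, #(R a) := by
    have hs : ∀ f : ι → ℕ, ∑ a, f a = f w + (f w' + ∑ a ∈ (univ.erase w).erase w', f a) := by
      intro f
      rw [add_sum_erase _ f (by simp [hw']), add_sum_erase _ f (mem_univ _)]
    rw [hs (fun a => #(R' a)), hs (fun a => #(R a)), ← hcardw', hRw, card_insert_of_notMem hxR]
    have : ∑ a ∈ (univ.erase w).erase w', #(R' a) = ∑ a ∈ (univ.erase w).erase w', #(R a) := by
      apply sum_congr rfl
      intro a ha
      simp only [mem_erase, mem_univ, and_true] at ha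
      rw [hR'a a ha.2, erase_eq_of_notMem (hyw a ha.1)]
    omega
  refine ⟨ψ', R', ⟨hstate, fun ψ'' R'' h => (hmax.max _ _ h).trans hsum.ge⟩, ?_, ?_⟩
  · have := hmax.card_le w'
    omega
  · intro a v hv
    by_cases ha : a = w
    · rw [ha, hRw, mem_insert] at hv
      exact hv.imp id fun h => ⟨w, h⟩
    · rw [hR'a a ha] at hv
      exact Or.inr ⟨a, mem_of_mem_erase hv⟩

include hdeg hlow hdisj hw hx hxR hj hjR in
/-- If `u` is the only blocker of `x` for the color `j`, some representative `y` reachable from `u`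
is witnessed by an edge `z y` with colors `ψ x` and `j`: otherwise these two colors could be
exchanged on the tight vertices reachable from `u`, which makes `j` available at `x`. -/
lemma exists_edge {u : V} (hu : blockers H ψ R x j = {u}) :
    ∃ z y, H.Adj z y ∧ (∃ a, y ∈ R a) ∧ Relation.ReflTransGen (H.TightStep C) u y ∧
      ((ψ z = ψ x ∧ ψ y = j) ∨ (ψ z = j ∧ ψ y = ψ x)) ∧
      (z = x ∨ (Fintype.card C ≤ H.degree z ∧ Fintype.card C ≤ H.degree u ∧
        Relation.ReflTransGen (H.TightStep C) u z)) := by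
  have huB : u ∈ blockers H ψ R x j := by simp [hu]
  simp only [blockers, mem_filter, mem_univ, true_and] at huB
  obtain ⟨hxu, huj, hu'⟩ := huB
  by_cases hut : Fintype.card C ≤ H.degree u
  swap
  · exact ⟨x, u, hxu, hu'.resolve_right hut, .refl, Or.inl ⟨rfl, huj⟩, Or.inl rfl⟩
  by_contra hno
  push Not at hno
  set S : Finset V := {z | Fintype.card C ≤ H.degree z ∧
    Relation.ReflTransGen (H.TightStep C) u z} with hS
  set W : Finset V := {v | H.Adj x v ∧ ψ v = j ∧ v ∉ S} with hW
  have huS : u ∈ S := by simp [hS, hut, Relation.ReflTransGen.refl]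
  have hxlow := hlow _ _ hx
  have hxS : x ∉ S := by simp only [hS, mem_filter, mem_univ, true_and]; omega
  have hmem : ∀ z ∈ S, Fintype.card C ≤ H.degree z ∧
    Relation.ReflTransGen (H.TightStep C) u z := fun z hz => by simpa [hS] using hz
  -- an edge leaving `S` towards a vertex other than `x` ends at a representative
  have hleave : ∀ a b, a ∈ S → b ∉ S → H.Adj a b → b ≠ x →
      ¬ ((ψ a = ψ x ∧ ψ b = j) ∨ (ψ a = j ∧ ψ b = ψ x)) := by
    intro a b ha hb hab hbx hcol
    obtain ⟨ha1, ha2⟩ := hmem a ha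
    have hub := ha2.tail ⟨hab, ha1⟩
    have hblow : H.degree b < Fintype.card C := by
      by_contra hcon
      exact hb (by simp only [hS, mem_filter, mem_univ, true_and]; exact ⟨by omega, hub⟩)
    have hbR := hmax.mem_of_reachable hdeg hlow hdisj hw hx hxR hj hjR hu hub hblow hbx
    exact (hno a b hab hbR hub hcol).2 ha1 hut ha2
  set ψ₁ : V → C := fun v => if v ∈ S then Equiv.swap (ψ x) j (ψ v) else Function.update ψ x j v
    with hψ₁
  have hS1 : ∀ v ∈ S, ψ₁ v = Equiv.swap (ψ x) j (ψ v) := fun v hv => by simp [hψ₁, hv]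
  have hnS1 : ∀ v ∉ S, v ≠ x → ψ₁ v = ψ v := fun v hv hvx => by simp [hψ₁, hv, hvx]
  have hx1 : ψ₁ x = j := by simp [hψ₁, hxS]
  have hpr : ∀ ⦃a b⦄, H.Adj a b → ψ a ≠ ψ b := fun a b hab =>
    hmax.proper hab (notMem_empty _) (notMem_empty _)
  have hSn : ∀ a b, a ∈ S → b ∉ S → H.Adj a b → ψ₁ a ≠ ψ₁ b := by
    intro a b ha hb hab heq
    rw [hS1 a ha] at heq
    by_cases hbx : b = x
    · subst hbx
      rw [hx1, Equiv.swap_apply_eq_iff, Equiv.swap_apply_right] at heq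
      exact hpr hab heq
    · rw [hnS1 b hb hbx] at heq
      have h0 := hpr hab
      have h4 := hleave a b ha hb hab hbx
      by_cases h5 : ψ a = ψ x
      · rw [h5, Equiv.swap_apply_left] at heq
        exact h4 (Or.inl ⟨h5, heq.symm⟩)
      · by_cases h6 : ψ a = j
        · rw [h6, Equiv.swap_apply_right] at heq
          exact h4 (Or.inr ⟨h6, heq.symm⟩)
        · rw [Equiv.swap_apply_of_ne_of_ne h5 h6] at heq
          exact h0 heq
  have hxn : ∀ b, b ∉ S → b ∉ W → H.Adj x b → ψ₁ x ≠ ψ₁ b := by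
    intro b hb hbW hab heq
    rw [hx1, hnS1 b hb hab.ne.symm] at heq
    exact hbW (by simp only [hW, mem_filter, mem_univ, true_and]; exact ⟨hab, heq.symm, hb⟩)
  have hprop : H.ProperOff W ψ₁ := by
    intro a b hab haW hbW
    by_cases ha : a ∈ S <;> by_cases hb : b ∈ S
    · rw [hS1 a ha, hS1 b hb]
      exact fun h => hpr hab ((Equiv.swap _ _).injective h)
    · exact hSn a b ha hb hab
    · exact (hSn b a hb ha hab.symm).symm
    · by_cases hax : a = x
      · subst hax; exact hxn b hb hbW hab
      · by_cases hbx : b = x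
        · subst hbx; exact (hxn a ha haW hab.symm).symm
        · rw [hnS1 a ha hax, hnS1 b hb hbx]; exact hpr hab
  have hB : ∀ v ∈ W, (∀ w, v ∉ R w) ∧ H.degree v < Fintype.card C := by
    intro v hv
    simp only [hW, mem_filter, mem_univ, true_and] at hv
    by_contra hcon
    have : v ∈ blockers H ψ R x j := by
      simp only [blockers, mem_filter, mem_univ, true_and]
      refine ⟨hv.1, hv.2.1, ?_⟩
      by_contra h2
      push Not at h2
      exact hcon h2
    rw [hu, mem_singleton] at this
    exact hv.2.2 (this ▸ huS)
  obtain ⟨ψ', h1, h2⟩ := SimpleGraph.ProperOff.fill_finset (U := ∅) W (by simpa using hprop)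
    (fun v hv => (hB v hv).2)
  have hxj : ψ' x = j := by rw [h2 x (by simp [hW]), hx1]
  refine hmax.false_of_recoloring hw hx hxR h1 (fun a v hv => ?_) (by rwa [hxj])
  have hvx : v ≠ x := by
    rintro rfl
    exact notMem_of_subset hdisj hx hxR hmax.subset a hv
  rw [h2 v (fun h => (hB v h).1 a hv), hnS1 v _ hvx]
  intro hvS
  have h5 := (hmem v hvS).1
  have h6 := hlow a v (hmax.subset a hv)
  omega

/-- The colors that would be new at `R w` and have a single blocker at `x`. -/
noncomputable def _root_.singlyBlocked (H : SimpleGraph V) (ψ : V → C) (R : ι → Finset V) (w : ι)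
    (x : V) : Finset C :=
  {j | j ≠ ψ x ∧ (∀ r ∈ R w, ψ r ≠ j) ∧ ∃ u, blockers H ψ R x j = {u}}

omit hmax in
lemma sum_card_blockers_le (J : Finset C) : ∑ j ∈ J, #(blockers H ψ R x j) ≤ H.degree x := by
  rw [← card_biUnion, ← H.card_neighborFinset_eq_degree]
  · apply card_le_card
    intro v hv
    simp only [mem_biUnion, blockers, mem_filter, mem_univ, true_and] at hv
    obtain ⟨j, -, h, -⟩ := hv
    simpa using h
  · intro a _ b _ hab
    rw [Function.onFun, disjoint_left]
    intro v hva hvb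
    simp only [blockers, mem_filter, mem_univ, true_and] at hva hvb
    exact hab (hva.2.1.symm.trans hvb.2.1)

include hlow hdisj hw hx hxR in
/-- Every color that would be new at `R w` has a blocker, and `x` has too few neighbors for many of
these colors to have two. -/
lemma le_card_singlyBlocked :
    Fintype.card C + 1 ≤ #(singlyBlocked H ψ R w x) + 2 * e w := by
  set J : Finset C := {j | j ≠ ψ x ∧ ∀ r ∈ R w, ψ r ≠ j} with hJ
  have hJcard : Fintype.card C ≤ #J + e w := by
    have h1 : (univ : Finset C) ⊆ J ∪ insert (ψ x) ((R w).image ψ) := by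
      intro j _
      simp only [hJ, mem_union, mem_filter, mem_univ, true_and, mem_insert, mem_image]
      by_contra! hcon
      obtain ⟨r, hr, hrj⟩ := hcon.1 hcon.2.1
      exact hcon.2.2 r hr hrj
    have h2 := (card_le_card h1).trans (card_union_le _ _)
    have h3 := card_insert_le (ψ x) ((R w).image ψ)
    have h4 := card_image_le (s := R w) (f := ψ)
    rw [card_univ] at h2
    omega
  have hsub : singlyBlocked H ψ R w x ⊆ J := by
    intro j hj
    simp only [singlyBlocked, mem_filter, mem_univ, true_and] at hj
    simp only [hJ, mem_filter, mem_univ, true_and]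
    exact ⟨hj.1, hj.2.1⟩
  have h1 : ∀ j ∈ J, 2 ≤ #(blockers H ψ R x j) + if j ∈ singlyBlocked H ψ R w x then 1 else 0 := by
    intro j hj
    simp only [hJ, mem_filter, mem_univ, true_and] at hj
    have := (hmax.blockers_nonempty hlow hdisj hw hx hxR hj.1 hj.2).card_pos
    by_cases h2 : #(blockers H ψ R x j) = 1
    · have : j ∈ singlyBlocked H ψ R w x := by
        simp only [singlyBlocked, mem_filter, mem_univ, true_and]
        exact ⟨hj.1, hj.2, card_eq_one.1 h2⟩
      simp [this, h2]
    · omega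
  have h2 := sum_le_sum h1
  rw [sum_add_distrib, sum_const, smul_eq_mul, ← sum_filter, ← card_eq_sum_ones,
    filter_mem_eq_inter, inter_eq_right.2 hsub] at h2
  have h3 := sum_card_blockers_le (H := H) (ψ := ψ) (R := R) (x := x) J
  have := hlow w x hx
  omega

include hdeg hlow hdisj hw hx hxR in
lemma card_liveNeighbors_add_card_singlyBlocked_le :
    #(liveNeighbors H C R x) + #(singlyBlocked H ψ R w x) ≤ H.degree x := by
  have hex : ∀ j ∈ singlyBlocked H ψ R w x, ∃ u, blockers H ψ R x j = {u} := by
    intro j hj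
    simp only [singlyBlocked, mem_filter, mem_univ, true_and] at hj
    exact hj.2.2
  have : Nonempty V := ⟨x⟩
  choose! u hu using hex
  have hub : ∀ j ∈ singlyBlocked H ψ R w x, H.Adj x (u j) ∧ ψ (u j) = j ∧
      ((∃ w, u j ∈ R w) ∨ Fintype.card C ≤ H.degree (u j)) := by
    intro j hj
    have : u j ∈ blockers H ψ R x j := by simp [hu j hj]
    simpa only [blockers, mem_filter, mem_univ, true_and] using this
  have hinj : Set.InjOn u (singlyBlocked H ψ R w x) := by
    intro a ha b hb hab
    rw [← (hub a ha).2.1, hab, (hub b hb).2.1]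
  rw [← card_image_of_injOn hinj, ← card_union_of_disjoint, ← H.card_neighborFinset_eq_degree]
  · apply card_le_card
    intro v hv
    rw [mem_union, mem_image] at hv
    rcases hv with hv | ⟨j, hj, rfl⟩
    · simp only [liveNeighbors, mem_filter, mem_univ, true_and] at hv
      simpa using hv.1
    · simpa using (hub j hj).1
  · rw [disjoint_left]
    intro v hv hv'
    obtain ⟨j, hj, rfl⟩ := mem_image.1 hv'
    simp only [liveNeighbors, mem_filter, mem_univ, true_and] at hv
    obtain ⟨-, s, hsx, hsR, hsl, hreach⟩ := hv
    have hj' := hj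
    simp only [singlyBlocked, mem_filter, mem_univ, true_and] at hj'
    obtain ⟨a, ha⟩ := hmax.mem_of_reachable hdeg hlow hdisj hw hx hxR hj'.1 hj'.2.1 (hu j hj)
      hreach hsl hsx
    exact hsR a ha

end IsMaxRainbowSystem

end RainbowSystem

/-! ### Rainbow systems: existence of full systems -/

section RainbowTheorem

variable {V C ι : Type*} [Fintype V] [Fintype C] [Fintype ι] {H : SimpleGraph V}
  {P : ι → Finset V} {e : ι → ℕ}

/-- `deficientWithin C H P e R₀ n` consists of the indices that can be made deficient in at most `n`
rounds of exchanges starting from `R₀`: in round `n + 1` by a maximal rainbow system all of whose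
representatives are representatives of `R₀` or belong to sets `P w` of an earlier round. -/
def deficientWithin (C : Type*) [Fintype C] (H : SimpleGraph V) (P : ι → Finset V) (e : ι → ℕ)
    (R₀ : ι → Finset V) : ℕ → Set ι
  | 0 => ∅
  | n + 1 => {w | w ∈ deficientWithin C H P e R₀ n ∨ ∃ (ψ : V → C) (R : ι → Finset V),
      IsMaxRainbowSystem H P e ψ R ∧ #(R w) < e w ∧
      ∀ a, ∀ v ∈ R a, (∃ b, v ∈ R₀ b) ∨ ∃ b ∈ deficientWithin C H P e R₀ n, v ∈ P b}

lemma deficientWithin_mono (C : Type*) [Fintype C] (H : SimpleGraph V) (P : ι → Finset V)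
    (e : ι → ℕ) (R₀ : ι → Finset V) : Monotone (deficientWithin C H P e R₀) :=
  monotone_nat_of_le_succ fun _ _ hw => Or.inl hw

lemma exists_first_deficientWithin {R₀ : ι → Finset V} {w : ι}
    (hw : ∃ n, w ∈ deficientWithin C H P e R₀ n) :
    ∃ (n : ℕ) (ψ : V → C) (R : ι → Finset V), w ∉ deficientWithin C H P e R₀ n ∧
      w ∈ deficientWithin C H P e R₀ (n + 1) ∧ IsMaxRainbowSystem H P e ψ R ∧ #(R w) < e w ∧
      ∀ a, ∀ v ∈ R a, (∃ b, v ∈ R₀ b) ∨ ∃ b ∈ deficientWithin C H P e R₀ n, v ∈ P b := by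
  have hspec := Nat.find_spec hw
  have hmin := fun m => Nat.find_min hw (m := m)
  cases hn : Nat.find hw with
  | zero => rw [hn] at hspec; exact absurd hspec (Set.notMem_empty _)
  | succ n =>
    have h1 := hmin n (by omega)
    rw [hn] at hspec
    rcases id hspec with h | ⟨ψ, R, h2, h3, h4⟩
    · exact absurd h h1
    · exact ⟨n, ψ, R, h1, hspec, h2, h3, h4⟩

/-- The numerical end of `exists_rainbow_representatives`: here `α` is the number of colors, `N` and
`X` count vertices outside and inside the system of representatives, and `hcount` compares the edges
demanded by the former with those available. -/
lemma card_colors_le_of_count {α c N X : ℕ} (hc : 1 ≤ c) (hN : 0 < N)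
    (hXN : (c + 1) * X ≤ c * N) (hα : 4 * c ≤ α + 3)
    (hcount : N * (α + 1 - 2 * c) ≤ (α - 1) * X + (2 * c - 2) * N) : α + 3 ≤ 4 * c ^ 2 := by
  obtain ⟨s, hs⟩ := Nat.exists_eq_add_of_le hα
  have e1 : α + 1 - 2 * c = (s + (2 * c - 2)) := by omega
  have e2 : α - 1 = s + 4 * c - 4 := by omega
  rw [e1, mul_add, mul_comm (2 * c - 2) N] at hcount
  have h1 : N * s ≤ (α - 1) * X := by omega
  have h2 : (c + 1) * (N * s) ≤ (α - 1) * (c * N) := by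
    calc (c + 1) * (N * s) ≤ (c + 1) * ((α - 1) * X) := by gcongr
      _ = (α - 1) * ((c + 1) * X) := by ring
      _ ≤ _ := by gcongr
  have h3 : (c + 1) * s ≤ (α - 1) * c := by
    apply Nat.le_of_mul_le_mul_left _ hN
    linarith
  obtain ⟨c, rfl⟩ := Nat.exists_eq_add_of_le hc
  have e3 : α - 1 = s + 4 * c := by omega
  rw [e3] at h3
  have : α + 3 = 4 * (1 + c) + s := hs
  rw [this]
  nlinarith

lemma exists_isMaxRainbowSystem {ψ₀ : V → C} (hψ₀ : H.ProperOff ∅ ψ₀) :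
    ∃ (ψ : V → C) (R : ι → Finset V), IsMaxRainbowSystem H P e ψ R := by
  obtain ⟨⟨ψ, R⟩, h1, h2⟩ := exists_max_image
    (univ.filter fun s : (V → C) × (ι → Finset V) => IsRainbowSystem H P e s.1 s.2)
    (fun s => ∑ w, #(s.2 w)) ⟨(ψ₀, fun _ => ∅), by
      simp only [mem_filter, mem_univ, true_and]
      exact ⟨hψ₀, by simp, by simp, by simp⟩⟩
  simp only [mem_filter, mem_univ, true_and] at h1
  exact ⟨ψ, R, h1, fun ψ' R' h => h2 (ψ', R') (by simpa using h)⟩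

/-- Let the sets `P w` be pairwise disjoint, consist of vertices with fewer neighbors than there are
colors, and have more than twice as many vertices as the number `e w ≤ c` of colors wanted on them.
Then a graph with a proper coloring has one with `e w` colors on every `P w`, if the number of
colors is not smaller than the maximum degree and than `4 c ^ 2 - 2`. -/
theorem exists_rainbow_representatives {c : ℕ} (hc : 1 ≤ c) (hα : 4 * c ^ 2 < Fintype.card C + 3)
    (hdeg : ∀ v, H.degree v ≤ Fintype.card C)
    (hlow : ∀ w, ∀ v ∈ P w, H.degree v < Fintype.card C)
    (hdisj : ∀ w w', ∀ v, v ∈ P w → v ∈ P w' → w = w')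
    (hec : ∀ w, e w ≤ c) (heP : ∀ w, 2 * e w + 1 ≤ #(P w))
    {ψ₀ : V → C} (hψ₀ : H.ProperOff ∅ ψ₀) :
    ∃ (ψ : V → C) (R : ι → Finset V), H.ProperOff ∅ ψ ∧
      ∀ w, R w ⊆ P w ∧ #(R w) = e w ∧ Set.InjOn ψ (R w) := by
  obtain ⟨ψ₁, R₀, hmax₀⟩ := exists_isMaxRainbowSystem (P := P) (e := e) hψ₀
  by_cases hdone : ∀ w, #(R₀ w) = e w
  · exact ⟨ψ₁, R₀, hmax₀.proper, fun w => ⟨hmax₀.subset w, hdone w, hmax₀.injOn w⟩⟩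
  exfalso
  push Not at hdone
  obtain ⟨w₀, hw₀⟩ := hdone
  set B := deficientWithin C H P e R₀ with hB
  have hBmono : Monotone B := deficientWithin_mono C H P e R₀
  have hw₀B : ∃ n, w₀ ∈ B n :=
    ⟨1, Or.inr ⟨ψ₁, R₀, hmax₀, lt_of_le_of_ne (hmax₀.card_le w₀) hw₀, fun a v hv => Or.inl ⟨a, hv⟩⟩⟩
  set A : Finset ι := {w | ∃ n, w ∈ B n} with hA
  have hAB : ∀ w ∈ A, ∃ n, w ∈ B n := fun w hw => by simpa [hA] using hw
  have hBA : ∀ n, ∀ w ∈ B n, w ∈ A := fun n w hw => by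
    simp only [hA, mem_filter, mem_univ, true_and]; exact ⟨n, hw⟩
  have : Nonempty (V → C) := ⟨ψ₀⟩
  choose! n ψ R hnB hnB' hmax hwdef hRsub using
    fun w (hw : w ∈ A) => exists_first_deficientWithin (hAB w hw)
  -- an index enters `B` at time `n w + 1`
  have hnlt : ∀ w ∈ A, ∀ m, w ∈ B m → n w < m := by
    intro w hw m hm
    by_contra! hcon
    exact hnB w hw (hBmono hcon hm)
  set N : Finset V := A.biUnion fun w => P w \ R₀ w with hN
  have hNmem : ∀ x, x ∈ N ↔ ∃ w ∈ A, x ∈ P w ∧ x ∉ R₀ w := by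
    intro x; simp [hN]
  have hex : ∀ x ∈ N, ∃ w ∈ A, x ∈ P w ∧ x ∉ R₀ w := fun x hx => (hNmem x).1 hx
  have : Nonempty ι := ⟨w₀⟩
  choose! o hoA hoP hoR₀ using hex
  have hfree₀ : ∀ x ∈ N, ∀ a, x ∉ R₀ a := fun x hx =>
    IsMaxRainbowSystem.notMem_of_subset hdisj (hoP x hx) (hoR₀ x hx) hmax₀.subset
  -- vertices of later sets are free in the systems of earlier indices
  have hfree : ∀ x ∈ N, ∀ w ∈ A, n w ≤ n (o x) → ∀ a, x ∉ R w a := by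
    intro x hx w hw hle a hxa
    rcases hRsub w hw a x hxa with ⟨b, hb⟩ | ⟨b, hb, hxb⟩
    · exact hfree₀ x hx b hb
    · have : b = o x := hdisj _ _ x hxb (hoP x hx)
      subst this
      exact hnB _ (hoA x hx) (hBmono hle hb)
  have hfree' : ∀ x ∈ N, x ∉ R (o x) (o x) := fun x hx => hfree x hx _ (hoA x hx) le_rfl _
  set XA : Finset V := A.biUnion R₀ with hXA
  set Γ : V → Finset C := fun x => singlyBlocked H (ψ (o x)) (R (o x)) (o x) x with hΓ
  set L : V → Finset V := fun y => liveNeighbors H C (R (o y)) y with hL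
  have hΓcard : ∀ x ∈ N, Fintype.card C + 1 ≤ #(Γ x) + 2 * c := by
    intro x hx
    have h1 := (hmax _ (hoA x hx)).le_card_singlyBlocked hlow hdisj (hwdef _ (hoA x hx))
      (hoP x hx) (hfree' x hx)
    have h2 := hec (o x)
    simp only [hΓ]
    omega
  have hLcard : ∀ x ∈ N, #(L x) ≤ 2 * c - 2 := by
    intro x hx
    have h1 := (hmax _ (hoA x hx)).card_liveNeighbors_add_card_singlyBlocked_le hdeg hlow hdisj
      (hwdef _ (hoA x hx)) (hoP x hx) (hfree' x hx)
    have h2 := hΓcard x hx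
    have h3 := hlow _ _ (hoP x hx)
    simp only [hΓ] at h2
    simp only [hL]
    omega
  have hedge : ∀ q : (_ : V) × C, q ∈ N.sigma Γ → ∃ u z y, H.Adj z y ∧
      blockers H (ψ (o q.1)) (R (o q.1)) q.1 q.2 = {u} ∧
      (∃ a, y ∈ R (o q.1) a) ∧ Relation.ReflTransGen (H.TightStep C) u y ∧
      ((ψ (o q.1) z = ψ (o q.1) q.1 ∧ ψ (o q.1) y = q.2) ∨
        (ψ (o q.1) z = q.2 ∧ ψ (o q.1) y = ψ (o q.1) q.1)) ∧
      (z = q.1 ∨ (Fintype.card C ≤ H.degree z ∧ Fintype.card C ≤ H.degree u ∧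
        Relation.ReflTransGen (H.TightStep C) u z)) := by
    rintro ⟨x, j⟩ hq
    rw [mem_sigma] at hq
    obtain ⟨hx, hj⟩ := hq
    simp only [hΓ, singlyBlocked, mem_filter, mem_univ, true_and] at hj
    obtain ⟨hj, hjR, u, hu⟩ := hj
    obtain ⟨z, y, h1, h2⟩ := (hmax _ (hoA x hx)).exists_edge hdeg hlow hdisj (hwdef _ (hoA x hx))
      (hoP x hx) (hfree' x hx) hj hjR hu
    exact ⟨u, z, y, h1, hu, h2⟩
  have : Nonempty V := by
    obtain ⟨v, -⟩ : (P w₀).Nonempty := card_pos.1 (by have := heP w₀; omega)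
    exact ⟨v⟩
  choose! u z y hzy hub hyR huy hcol hz using hedge
  have hΓmem : ∀ q ∈ N.sigma Γ, q.1 ∈ N ∧ q.2 ≠ ψ (o q.1) q.1 ∧
      ∀ r ∈ R (o q.1) (o q.1), ψ (o q.1) r ≠ q.2 := by
    rintro ⟨x, j⟩ hq
    rw [mem_sigma] at hq
    obtain ⟨hx, hj⟩ := hq
    simp only [hΓ, singlyBlocked, mem_filter, mem_univ, true_and] at hj
    exact ⟨hx, hj.1, hj.2.1⟩
  have hNlow : ∀ x ∈ N, H.degree x < Fintype.card C := fun x hx => hlow _ _ (hoP x hx)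
  have huadj : ∀ q ∈ N.sigma Γ, H.Adj q.1 (u q) := by
    intro q hq
    have : u q ∈ blockers H (ψ (o q.1)) (R (o q.1)) q.1 q.2 := by simp [hub q hq]
    simp only [blockers, mem_filter, mem_univ, true_and] at this
    exact this.1
  -- from a tight `z` one gets back to the vertex for which it was chosen
  have hback : ∀ q ∈ N.sigma Γ, z q ≠ q.1 → Fintype.card C ≤ H.degree (z q) ∧
      Relation.ReflTransGen (H.TightStep C) (z q) q.1 := by
    intro q hq hne
    obtain ⟨h1, h2, h3⟩ := (hz q hq).resolve_left hne
    exact ⟨h1, (reflTransGen_tightStep_symm h3 h1).2.tail ⟨(huadj q hq).symm, h2⟩⟩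
  have hfst : ∀ q ∈ N.sigma Γ, ∀ q' ∈ N.sigma Γ, z q = z q' → n (o q.1) ≤ n (o q'.1) →
      q.1 = q'.1 := by
    intro q hq q' hq' hzz hle
    obtain ⟨hx, hj, hjR⟩ := hΓmem q hq
    obtain ⟨hx', -, -⟩ := hΓmem q' hq'
    by_contra hne
    by_cases h1 : z q = q.1
    · have h2 := (hback q' hq' (fun h => hne (by rw [← h1, hzz, h]))).1
      rw [← hzz, h1] at h2
      have := hNlow _ hx
      omega
    · by_cases h2 : z q' = q'.1
      · have h3 := (hback q hq h1).1
        rw [hzz, h2] at h3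
        have := hNlow _ hx'
        omega
      · have h3 := (hz q hq).resolve_left h1
        have h4 := (hback q' hq' h2).2
        rw [← hzz] at h4
        obtain ⟨a, ha⟩ := (hmax _ (hoA _ hx)).mem_of_reachable hdeg hlow hdisj (hwdef _ (hoA _ hx))
          (hoP _ hx) (hfree' _ hx) hj hjR (hub q hq) (h3.2.2.trans h4) (hNlow _ hx') (Ne.symm hne)
        exact hfree _ hx' _ (hoA _ hx) hle a ha
  have hinj : Set.InjOn (fun q => (⟨y q, z q⟩ : (_ : V) × V)) (N.sigma Γ) := by
    intro q hq q' hq' heq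
    rw [mem_coe] at hq hq'
    simp only [Sigma.mk.injEq, heq_eq_eq] at heq
    obtain ⟨hyy, hzz⟩ := heq
    have h1 : q.1 = q'.1 := by
      rcases le_total (n (o q.1)) (n (o q'.1)) with h | h
      · exact hfst q hq q' hq' hzz h
      · exact (hfst q' hq' q hq hzz.symm h).symm
    have h2 := hcol q hq
    have h3 := hcol q' hq'
    have h4 := (hΓmem q hq).2.1
    have h5 := (hΓmem q' hq').2.1
    rw [← h1] at h3 h5
    rw [← hyy, ← hzz] at h3
    obtain ⟨x, j⟩ := q
    obtain ⟨x', j'⟩ := q'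
    dsimp only at h1 h2 h3 h4 h5
    subst h1
    have : j = j' := by
      rcases h2 with ⟨a, b⟩ | ⟨a, b⟩ <;> rcases h3 with ⟨a', b'⟩ | ⟨a', b'⟩
      · rw [← b, b']
      · exact absurd (a'.symm.trans a) h5
      · exact absurd (a.symm.trans a') h4
      · rw [← a, a']
    rw [this]
  have hmaps : ∀ q ∈ N.sigma Γ, (⟨y q, z q⟩ : (_ : V) × V) ∈
      XA.sigma (fun y => H.neighborFinset y) ∪ N.sigma L := by
    intro q hq
    obtain ⟨hx, hj, hjR⟩ := hΓmem q hq
    have hoq := hoA _ hx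
    obtain ⟨a, hya⟩ := hyR q hq
    have hylow := hlow _ _ ((hmax _ hoq).subset a hya)
    have hyx : y q ≠ q.1 := by
      intro h
      rw [h] at hya
      exact hfree _ hx _ hoq le_rfl a hya
    rw [mem_union, mem_sigma, mem_sigma]
    rcases hRsub _ hoq a _ hya with ⟨w', hw'⟩ | ⟨w', hw'B, hyw'⟩
    · left
      refine ⟨?_, by simpa using (hzy q hq).symm⟩
      simp only [hXA, mem_biUnion]
      refine ⟨w', ?_, hw'⟩
      have haw : a = w' := hdisj _ _ _ ((hmax _ hoq).subset a hya) (hmax₀.subset w' hw')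
      subst haw
      by_cases hao : a = o q.1
      · rw [hao]; exact hoq
      obtain ⟨ψ', R', h1, h2, h3⟩ := (hmax _ hoq).exists_exchange hdeg hlow hdisj
        (hwdef _ hoq) (hoP _ hx) (hfree' _ hx) hj hjR (hub q hq) (huy q hq) hao hya
      refine hBA (n (o q.1) + 2) a (Or.inr ⟨ψ', R', h1, h2, fun b v hv => ?_⟩)
      rcases h3 b v hv with rfl | ⟨b', hb'⟩
      · exact Or.inr ⟨_, hnB' _ hoq, hoP _ hx⟩
      · rcases hRsub _ hoq b' v hb' with h | ⟨b'', h4, h5⟩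
        · exact Or.inl h
        · exact Or.inr ⟨b'', hBmono (Nat.le_succ _) h4, h5⟩
    · by_cases hy0 : ∃ b, y q ∈ R₀ b
      · obtain ⟨b, hb⟩ := hy0
        have hbw : b = w' := hdisj _ _ _ (hmax₀.subset b hb) hyw'
        left
        refine ⟨?_, by simpa using (hzy q hq).symm⟩
        simp only [hXA, mem_biUnion]
        exact ⟨b, hbw ▸ hBA _ _ hw'B, hb⟩
      · right
        push Not at hy0
        have hyN : y q ∈ N := (hNmem _).2 ⟨w', hBA _ _ hw'B, hyw', hy0 w'⟩
        have how : o (y q) = w' := hdisj _ _ _ (hoP _ hyN) hyw'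
        have hle : n (o (y q)) ≤ n (o q.1) := by
          rw [how]; exact (hnlt w' (hBA _ _ hw'B) _ hw'B).le
        refine ⟨hyN, ?_⟩
        simp only [hL, liveNeighbors, mem_filter, mem_univ, true_and]
        refine ⟨(hzy q hq).symm, q.1, hyx.symm, hfree _ hx _ (hoA _ hyN) hle, hNlow _ hx, ?_⟩
        by_cases h1 : z q = q.1
        · rw [h1]
        · exact (hback q hq h1).2
  have hcard := card_le_card_of_injOn _ hmaps hinj
  have h1 : #N * (Fintype.card C + 1 - 2 * c) ≤ #(N.sigma Γ) := by
    rw [card_sigma, ← smul_eq_mul]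
    exact card_nsmul_le_sum _ _ _ fun x hx => by have := hΓcard x hx; omega
  have h2 : #(XA.sigma (fun y => H.neighborFinset y)) ≤ (Fintype.card C - 1) * #XA := by
    rw [card_sigma, mul_comm, ← smul_eq_mul]
    apply sum_le_card_nsmul
    intro v hv
    simp only [hXA, mem_biUnion] at hv
    obtain ⟨w, -, hv⟩ := hv
    have := hlow w v (hmax₀.subset w hv)
    rw [H.card_neighborFinset_eq_degree]
    omega
  have h3 : #(N.sigma L) ≤ (2 * c - 2) * #N := by
    rw [card_sigma, mul_comm, ← smul_eq_mul]
    exact sum_le_card_nsmul _ _ _ hLcard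
  have hNcard : #N = ∑ w ∈ A, #(P w \ R₀ w) := by
    apply card_biUnion
    intro a _ b _ hab
    rw [Function.onFun, disjoint_left]
    intro v hva hvb
    exact hab (hdisj _ _ v (sdiff_subset hva) (sdiff_subset hvb))
  have hNw : ∀ w, e w + 1 ≤ #(P w \ R₀ w) := by
    intro w
    have h4 := le_card_sdiff (R₀ w) (P w)
    have h5 := heP w
    have h6 := hmax₀.card_le w
    omega
  have hXN : (c + 1) * #XA ≤ c * #N := by
    calc (c + 1) * #XA ≤ (c + 1) * ∑ w ∈ A, #(R₀ w) := by
          gcongr; exact card_biUnion_le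
      _ = ∑ w ∈ A, (c + 1) * #(R₀ w) := mul_sum _ _ _
      _ ≤ ∑ w ∈ A, c * #(P w \ R₀ w) := by
          apply sum_le_sum
          intro w _
          have h5 := hec w
          calc (c + 1) * #(R₀ w) ≤ (c + 1) * e w := by gcongr; exact hmax₀.card_le w
            _ ≤ c * (e w + 1) := by nlinarith
            _ ≤ _ := by gcongr; exact hNw w
      _ = c * #N := by rw [hNcard, mul_sum]
  have hNpos : 0 < #N := by
    have hwA : w₀ ∈ A := by simpa [hA] using hw₀B
    rw [hNcard]
    exact (Nat.succ_pos _).trans_le ((hNw w₀).trans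
      (single_le_sum (f := fun w => #(P w \ R₀ w)) (fun _ _ => Nat.zero_le _) hwA))
  have hfin := card_colors_le_of_count hc hNpos hXN (by nlinarith)
    (h1.trans (hcard.trans ((card_union_le _ _).trans (add_le_add h2 h3))))
  omega

end RainbowTheorem

/-! ### Colorings of least energy -/

section Energy

variable {V C I : Type*} [Fintype V] [Fintype C] [Fintype I] {G : SimpleGraph V} {pal : C → I}

/-- The number of neighbors of `x` in the part `i` of the vertex partition `f`. -/
noncomputable def partDegree (G : SimpleGraph V) (f : V → I) (i : I) (x : V) : ℕ :=
  #{u | G.Adj x u ∧ f u = i}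

/-- The parts of the vertex partition `f` in which `x` has a neighbor. -/
noncomputable def seenParts (G : SimpleGraph V) (f : V → I) (x : V) : Finset I :=
  (G.neighborFinset x).image f

/-- The number of colors in the palette of the part `i`. -/
noncomputable def paletteSize (pal : C → I) (i : I) : ℕ := #{k | pal k = i}

/-- Twice the number of edges inside the parts of `f`, minus twice the sum over all vertices of the
size of their palettes. -/
noncomputable def partEnergy (G : SimpleGraph V) (pal : C → I) (f : V → I) : ℤ :=
  ∑ v, ∑ u, (if G.Adj v u ∧ f u = f v then (1 : ℤ) else 0) - 2 * ∑ v, (paletteSize pal (f v) : ℤ)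

/-- A proper coloring whose induced vertex partition `pal ∘ φ` has the least energy. -/
structure IsMinEnergyColoring (G : SimpleGraph V) (pal : C → I) (φ : V → C) : Prop where
  proper : G.ProperOff ∅ φ
  min : ∀ φ', G.ProperOff ∅ φ' → partEnergy G pal (pal ∘ φ) ≤ partEnergy G pal (pal ∘ φ')

lemma mem_seenParts {f : V → I} {x : V} {i : I} :
    i ∈ seenParts G f x ↔ ∃ u, G.Adj x u ∧ f u = i := by
  simp [seenParts]

lemma sum_partDegree (f : V → I) (x : V) : ∑ i, partDegree G f i x = G.degree x := by
  rw [← G.card_neighborFinset_eq_degree,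
    card_eq_sum_card_fiberwise (f := f) (t := univ) (by simp)]
  apply sum_congr rfl
  intro i _
  unfold partDegree
  congr 1
  ext u
  simp

lemma partDegree_eq_zero {f : V → I} {x : V} {i : I} (h : i ∉ seenParts G f x) :
    partDegree G f i x = 0 := by
  rw [partDegree, card_eq_zero, filter_eq_empty_iff]
  intro u _ hu
  exact h (mem_seenParts.2 ⟨u, hu⟩)

lemma sum_paletteSize (pal : C → I) : ∑ i, paletteSize pal i = Fintype.card C := by
  rw [← card_univ, card_eq_sum_card_fiberwise (f := pal) (t := univ) (by simp)]
  rfl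

lemma sum_sum_adj_eq (f : V → I) (x : V) :
    ∑ v, ∑ u, (if G.Adj v u ∧ f u = f v then (1 : ℤ) else 0) = 2 * partDegree G f (f x) x +
      ∑ v ∈ univ.erase x, ∑ u ∈ univ.erase x, (if G.Adj v u ∧ f u = f v then (1 : ℤ) else 0) := by
  have h1 : ∑ u, (if G.Adj x u ∧ f u = f x then (1 : ℤ) else 0) = partDegree G f (f x) x := by
    rw [partDegree, sum_boole]
  have h2 : ∑ v ∈ univ.erase x, (if G.Adj v x ∧ f x = f v then (1 : ℤ) else 0) =
      partDegree G f (f x) x := by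
    rw [sum_erase _ (by simp), ← h1]
    apply sum_congr rfl
    intro v _
    rw [G.adj_comm, eq_comm (a := f x)]
  rw [← add_sum_erase _ _ (mem_univ x), h1]
  have h3 : ∀ v ∈ univ.erase x, ∑ u, (if G.Adj v u ∧ f u = f v then (1 : ℤ) else 0) =
      (if G.Adj v x ∧ f x = f v then (1 : ℤ) else 0) +
      ∑ u ∈ univ.erase x, (if G.Adj v u ∧ f u = f v then (1 : ℤ) else 0) :=
    fun v _ => (add_sum_erase _ _ (mem_univ x)).symm
  rw [sum_congr rfl h3, sum_add_distrib, h2]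
  ring

lemma partDegree_update_self (f : V → I) (x : V) (i j : I) :
    partDegree G (Function.update f x j) i x = partDegree G f i x := by
  unfold partDegree
  congr 1
  ext u
  simp only [mem_filter, mem_univ, true_and, and_congr_right_iff]
  intro hu
  rw [Function.update_of_ne hu.ne.symm]

/-- Moving `x` from its part to `j` trades the edges from `x` to its part for those to `j`, and the
palette size of its part for that of `j`. -/
lemma partEnergy_update (f : V → I) (x : V) (j : I) :
    partEnergy G pal (Function.update f x j) = partEnergy G pal f +
      2 * ((partDegree G f j x - paletteSize pal j : ℤ) -
        (partDegree G f (f x) x - paletteSize pal (f x))) := by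
  unfold partEnergy
  rw [sum_sum_adj_eq f x, sum_sum_adj_eq (Function.update f x j) x, Function.update_self,
    partDegree_update_self, ← add_sum_erase _ _ (mem_univ x),
    ← add_sum_erase _ (fun v => (paletteSize pal (f v) : ℤ)) (mem_univ x), Function.update_self]
  have hne : ∀ v ∈ univ.erase x, Function.update f x j v = f v := fun v hv =>
    Function.update_of_ne (ne_of_mem_erase hv) _ _
  have h1 : ∑ v ∈ univ.erase x, (paletteSize pal (Function.update f x j v) : ℤ) =
      ∑ v ∈ univ.erase x, (paletteSize pal (f v) : ℤ) :=
    sum_congr rfl fun v hv => by rw [hne v hv]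
  have h2 : ∑ v ∈ univ.erase x, ∑ u ∈ univ.erase x,
      (if G.Adj v u ∧ Function.update f x j u = Function.update f x j v then (1 : ℤ) else 0) =
      ∑ v ∈ univ.erase x, ∑ u ∈ univ.erase x,
      (if G.Adj v u ∧ f u = f v then (1 : ℤ) else 0) :=
    sum_congr rfl fun v hv => sum_congr rfl fun u hu => by rw [hne v hv, hne u hu]
  rw [h1, h2]
  ring

lemma exists_isMinEnergyColoring (pal : C → I) {φ₀ : V → C} (h : G.ProperOff ∅ φ₀) :
    ∃ φ, IsMinEnergyColoring G pal φ := by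
  obtain ⟨φ, h1, h2⟩ := exists_min_image (univ.filter fun φ : V → C => G.ProperOff ∅ φ)
    (fun φ => partEnergy G pal (pal ∘ φ)) ⟨φ₀, by simpa using h⟩
  exact ⟨φ, by simpa using h1, fun φ' hφ' => h2 φ' (by simpa using hφ')⟩

/-- A vertex can be moved to any part in which it has fewer neighbors than there are colors. -/
lemma SimpleGraph.ProperOff.exists_move {φ : V → C} (h : G.ProperOff ∅ φ) {x : V} {j : I}
    (hj : partDegree G (pal ∘ φ) j x < paletteSize pal j) :
    ∃ k, pal k = j ∧ G.ProperOff ∅ (Function.update φ x k) := by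
  have hlt : #(({u | G.Adj x u ∧ (pal ∘ φ) u = j} : Finset V).image φ) <
      #({k | pal k = j} : Finset C) := card_image_le.trans_lt hj
  obtain ⟨k, hk, hk'⟩ := exists_mem_notMem_of_card_lt_card hlt
  simp only [mem_filter, mem_univ, true_and] at hk
  have hupd := h.update (v := x) (k := k) fun u hu _ huk =>
    hk' (mem_image.2 ⟨u, by simp [hu, huk, hk], huk⟩)
  exact ⟨k, hk, by simpa using hupd⟩

namespace IsMinEnergyColoring

variable {φ : V → C}

/-- A vertex with room in the part `j` does not prefer `j` to its own part. -/
lemma le_of_lt (h : IsMinEnergyColoring G pal φ) {x : V} {j : I}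
    (hj : partDegree G (pal ∘ φ) j x < paletteSize pal j) :
    partDegree G (pal ∘ φ) (pal (φ x)) x + paletteSize pal j ≤
      partDegree G (pal ∘ φ) j x + paletteSize pal (pal (φ x)) := by
  obtain ⟨k, rfl, hk⟩ := h.proper.exists_move hj
  have h1 := h.min _ hk
  rw [Function.comp_update, partEnergy_update] at h1
  simp only [Function.comp_apply] at h1
  omega

/-- A recoloring of a single vertex that does not increase the energy keeps it minimal. -/
lemma exists_move_eq (h : IsMinEnergyColoring G pal φ) {x : V} {j : I}
    (hj : partDegree G (pal ∘ φ) j x < paletteSize pal j)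
    (hle : partDegree G (pal ∘ φ) j x + paletteSize pal (pal (φ x)) ≤
      partDegree G (pal ∘ φ) (pal (φ x)) x + paletteSize pal j) :
    ∃ k, pal k = j ∧ IsMinEnergyColoring G pal (Function.update φ x k) := by
  obtain ⟨k, rfl, hk⟩ := h.proper.exists_move hj
  refine ⟨k, rfl, hk, fun φ' hφ' => le_trans ?_ (h.min φ' hφ')⟩
  rw [Function.comp_update, partEnergy_update]
  simp only [Function.comp_apply]
  omega

variable (hdeg : ∀ v, G.degree v ≤ Fintype.card C)

include hdeg in
/-- Every vertex has at most as many neighbors in its own part as the palette of the part has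
colors: otherwise it would have room in another part. -/
lemma partDegree_le (h : IsMinEnergyColoring G pal φ) (x : V) :
    partDegree G (pal ∘ φ) (pal (φ x)) x ≤ paletteSize pal (pal (φ x)) := by
  by_contra! hcon
  obtain ⟨j, -, hj⟩ : ∃ j ∈ univ, partDegree G (pal ∘ φ) j x < paletteSize pal j := by
    by_contra! h2
    have h3 : ∑ i, paletteSize pal i < ∑ i, partDegree G (pal ∘ φ) i x :=
      sum_lt_sum h2 ⟨_, mem_univ _, hcon⟩
    rw [sum_partDegree, sum_paletteSize] at h3
    have := hdeg x
    omega
  have := h.le_of_lt hj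
  omega

include hdeg in
lemma partDegree_add_le (h : IsMinEnergyColoring G pal φ) (x : V) (j : I) :
    partDegree G (pal ∘ φ) (pal (φ x)) x + paletteSize pal j ≤
      partDegree G (pal ∘ φ) j x + paletteSize pal (pal (φ x)) := by
  by_cases hj : partDegree G (pal ∘ φ) j x < paletteSize pal j
  · exact h.le_of_lt hj
  · have := h.partDegree_le hdeg x
    omega

variable {b c : ℕ} (hpos : ∀ i, 0 < paletteSize pal i) (hb : ∀ i, paletteSize pal i ≤ b)
  (hbig : c + 1 ≤ #{i | paletteSize pal i = b})

include hpos hb hbig in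
/-- A vertex that sees few parts has no neighbor in its own part, and can be moved to another part
that it does not see. -/
lemma exists_move_of_card_seenParts_lt (h : IsMinEnergyColoring G pal φ) {w : V}
    (hw : #(seenParts G (pal ∘ φ) w) < c) :
    partDegree G (pal ∘ φ) (pal (φ w)) w = 0 ∧ ∃ k, pal k ≠ pal (φ w) ∧
      pal k ∉ seenParts G (pal ∘ φ) w ∧ IsMinEnergyColoring G pal (Function.update φ w k) := by
  obtain ⟨l, hl, hl'⟩ := exists_mem_notMem_of_card_lt_card
    (s := insert (pal (φ w)) (seenParts G (pal ∘ φ) w)) (t := {i | paletteSize pal i = b}) (by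
      have := card_insert_le (pal (φ w)) (seenParts G (pal ∘ φ) w)
      omega)
  simp only [mem_filter, mem_univ, true_and] at hl
  rw [mem_insert, not_or] at hl'
  have h0 := partDegree_eq_zero hl'.2
  have hlt : partDegree G (pal ∘ φ) l w < paletteSize pal l := by rw [h0]; exact hpos l
  have h1 := h.le_of_lt hlt
  have h2 := hb (pal (φ w))
  obtain ⟨k, rfl, hk⟩ := h.exists_move_eq hlt (by omega)
  exact ⟨by omega, k, hl'.1, hl'.2, hk⟩

lemma partDegree_update (f : V → I) {x w : V} (j l : I) (hxw : G.Adj x w) (hwj : f w = j)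
    (hl : l ≠ j) : partDegree G (Function.update f w l) j x + 1 = partDegree G f j x := by
  have hw : w ∈ ({u | G.Adj x u ∧ f u = j} : Finset V) := by simp [hxw, hwj]
  unfold partDegree
  rw [← card_erase_add_one hw]
  congr 2
  ext u
  by_cases huw : u = w
  · subst huw; simp [hl]
  · simp [huw]

lemma partDegree_update_of_ne (f : V → I) {x w : V} (i l : I) (hwi : f w ≠ i) (hl : l ≠ i) :
    partDegree G (Function.update f w l) i x = partDegree G f i x := by
  unfold partDegree
  congr 1
  ext u
  by_cases huw : u = w
  · subst huw; simp [hl, hwi]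
  · simp [huw]

include hdeg hpos hb hbig in
/-- If `x` has neighbors in another part `j` that see few parts, then these can be moved out of `j`
one after the other, and still `x` must not prefer `j` to its own part. -/
lemma partDegree_add_card_add_le (x : V) {j : I} (F : Finset V) :
    ∀ {φ : V → C}, IsMinEnergyColoring G pal φ → j ≠ pal (φ x) →
    (∀ w ∈ F, G.Adj x w ∧ pal (φ w) = j ∧ #(seenParts G (pal ∘ φ) w) < c) →
    partDegree G (pal ∘ φ) (pal (φ x)) x + #F + paletteSize pal j ≤
      partDegree G (pal ∘ φ) j x + paletteSize pal (pal (φ x)) := by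
  induction F using Finset.induction_on with
  | empty => intro φ h _ _; simpa using h.partDegree_add_le hdeg x j
  | insert w F hwF ih =>
    intro φ h hjx hF
    obtain ⟨hxw, hwj, hw⟩ := hF w (mem_insert_self _ _)
    obtain ⟨h0, k, hkw, hkS, hmin⟩ := h.exists_move_of_card_seenParts_lt hpos hb hbig hw
    have hxw' : x ≠ w := hxw.ne
    have hkx : pal k ≠ pal (φ x) := fun h => hkS (mem_seenParts.2 ⟨x, hxw.symm, h.symm⟩)
    have hφx : Function.update φ w k x = φ x := Function.update_of_ne hxw' _ _
    have h1 := ih hmin (by rwa [hφx]) (fun v hv => by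
      obtain ⟨hxv, hvj, hv'⟩ := hF v (mem_insert_of_mem hv)
      have hvw : v ≠ w := fun h => hwF (h ▸ hv)
      refine ⟨hxv, by rwa [Function.update_of_ne hvw], ?_⟩
      -- `v` and `w` are not adjacent, as `w` has no neighbor in its own part
      have hnadj : ¬ G.Adj v w := by
        intro hadj
        rw [partDegree, card_eq_zero, filter_eq_empty_iff] at h0
        exact h0 (mem_univ v) ⟨hadj.symm, by simp [hvj, hwj]⟩
      have : seenParts G (pal ∘ Function.update φ w k) v = seenParts G (pal ∘ φ) v := by
        apply image_congr
        intro u hu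
        have : u ≠ w := fun h => hnadj (by simpa [h] using hu)
        simp [Function.update_of_ne this]
      rwa [this])
    rw [hφx, Function.comp_update,
      partDegree_update_of_ne _ _ _ (by simpa [hwj] using hjx) hkx] at h1
    have h2 := partDegree_update (G := G) (pal ∘ φ) j (pal k) hxw (by simpa using hwj)
      (by rwa [← hwj])
    rw [card_insert_of_notMem hwF]
    omega

include hdeg hpos hb hbig in
/-- A vertex adjacent to many vertices that see few parts has many spare colors in its part. -/
lemma card_add_mul_le (h : IsMinEnergyColoring G pal φ) (x : V) :
    #{w | G.Adj x w ∧ #(seenParts G (pal ∘ φ) w) < c} +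
        Fintype.card I * partDegree G (pal ∘ φ) (pal (φ x)) x ≤
      Fintype.card I * paletteSize pal (pal (φ x)) := by
  set F : I → Finset V :=
    fun j => {w | G.Adj x w ∧ pal (φ w) = j ∧ #(seenParts G (pal ∘ φ) w) < c} with hF
  have h1 : ∀ j, partDegree G (pal ∘ φ) (pal (φ x)) x + #(F j) + paletteSize pal j ≤
      partDegree G (pal ∘ φ) j x + paletteSize pal (pal (φ x)) := by
    intro j
    by_cases hj : j = pal (φ x)
    · subst hj
      have : F (pal (φ x)) = ∅ := by
        simp only [hF, filter_eq_empty_iff]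
        rintro w - ⟨hxw, hwx, hw⟩
        have h0 := (h.exists_move_of_card_seenParts_lt hpos hb hbig hw).1
        rw [partDegree, card_eq_zero, filter_eq_empty_iff] at h0
        exact h0 (mem_univ x) ⟨hxw.symm, hwx.symm⟩
      simp [this]
    · exact partDegree_add_card_add_le hdeg hpos hb hbig x (F j) h hj
        (fun w hw => by simpa [hF] using hw)
  have h2 := sum_le_sum fun j (_ : j ∈ univ) => h1 j
  simp only [sum_add_distrib, sum_partDegree, sum_paletteSize, sum_const, card_univ,
    smul_eq_mul] at h2
  have h3 : #{w | G.Adj x w ∧ #(seenParts G (pal ∘ φ) w) < c} = ∑ j, #(F j) := by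
    rw [card_eq_sum_card_fiberwise (f := pal ∘ φ) (t := univ) (by simp)]
    apply sum_congr rfl
    intro j _
    congr 1
    ext w
    simp [hF]
    tauto
  have := hdeg x
  omega

end IsMinEnergyColoring

end Energy

/-! ### Selection of subsets and greedy recoloring -/

section Selection

variable {V C ι : Type*} [Fintype V] [Fintype C] [Fintype ι]

/-- If each `T w` has at least `m w * K` elements and no `x` lies in more than `K * cap x` of them,
then there are subsets of size `m w` such that no `x` lies in more than `cap x` of these. This is
Hall's theorem, after splitting each `T w` into `m w` pieces of size `K` and taking `cap x` copies
of every `x`. -/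
lemma exists_capped_subsets (T : ι → Finset V) (m : ι → ℕ) (cap : V → ℕ) {K : ℕ} (hK : 0 < K)
    (hT : ∀ w, m w * K ≤ #(T w)) (hcap : ∀ x, #{w | x ∈ T w} ≤ K * cap x) :
    ∃ R : ι → Finset V, (∀ w, R w ⊆ T w ∧ #(R w) = m w) ∧ ∀ x, #{w | x ∈ R w} ≤ cap x := by
  have hemb : ∀ w, ∃ g : Fin (m w) × Fin K → V, Function.Injective g ∧ ∀ a, g a ∈ T w := by
    intro w
    obtain ⟨g⟩ : Nonempty (Fin (m w) × Fin K ↪ T w) :=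
      Function.Embedding.nonempty_of_card_le (by simpa using hT w)
    exact ⟨fun a => g a, fun a b hab => g.injective (Subtype.ext hab), fun a => (g a).2⟩
  choose g hginj hgT using hemb
  set piece : (Σ w, Fin (m w)) → Finset V := fun q => univ.image fun i => g q.1 (q.2, i) with hpiece
  have hpcard : ∀ q, #(piece q) = K := by
    intro q
    rw [hpiece, card_image_of_injective]
    · simp
    · intro a b hab
      exact (Prod.ext_iff.1 (hginj q.1 hab)).2
  have hpdisj : ∀ (w : ι) (k k' : Fin (m w)) (x : V), x ∈ piece ⟨w, k⟩ → x ∈ piece ⟨w, k'⟩ →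
      k = k' := by
    intro w k k' x hx hx'
    simp only [hpiece, mem_image, mem_univ, true_and] at hx hx'
    obtain ⟨i, rfl⟩ := hx
    obtain ⟨i', hi'⟩ := hx'
    exact (Prod.ext_iff.1 (hginj w hi')).1.symm
  have hpT : ∀ q, piece q ⊆ T q.1 := by
    intro q x hx
    simp only [hpiece, mem_image, mem_univ, true_and] at hx
    obtain ⟨i, rfl⟩ := hx
    exact hgT _ _
  have hall : ∀ s : Finset (Σ w, Fin (m w)),
      #s ≤ #(s.biUnion fun q => (piece q).sigma fun x => (univ : Finset (Fin (cap x)))) := by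
    intro s
    have e1 : (s.biUnion fun q => (piece q).sigma fun x => (univ : Finset (Fin (cap x)))) =
        (s.biUnion piece).sigma fun x => univ := by
      ext ⟨x, i⟩; simp
    rw [e1, card_sigma]
    simp only [card_univ, Fintype.card_fin]
    have h1 : #(s.sigma piece) = #s * K := by
      rw [card_sigma, sum_congr rfl (fun q _ => hpcard q), sum_const, smul_eq_mul]
    have h2 : #(s.sigma piece) ≤ #((s.biUnion piece).sigma fun x => ({w | x ∈ T w} : Finset ι)) := by
      apply card_le_card_of_injOn (fun r => (⟨r.2, r.1.1⟩ : (_ : V) × ι))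
      · rintro ⟨q, x⟩ hr
        simp only [coe_sigma, Set.mem_sigma_iff, mem_coe] at hr
        simp only [coe_sigma, Set.mem_sigma_iff, mem_coe, mem_biUnion, mem_filter, mem_univ,
          true_and]
        exact ⟨⟨q, hr.1, hr.2⟩, hpT q hr.2⟩
      · rintro ⟨⟨w, k⟩, x⟩ hr ⟨⟨w', k'⟩, x'⟩ hr' heq
        simp only [coe_sigma, Set.mem_sigma_iff, mem_coe] at hr hr'
        simp only [Sigma.mk.injEq, heq_eq_eq] at heq
        obtain ⟨rfl, rfl⟩ := heq
        obtain rfl := hpdisj w k k' x hr.2 hr'.2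
        rfl
    rw [h1, card_sigma] at h2
    have h3 := h2.trans (sum_le_sum fun x _ => hcap x)
    rw [← mul_sum, mul_comm] at h3
    exact Nat.le_of_mul_le_mul_left h3 hK
  obtain ⟨h, hinj, hmem⟩ := (all_card_le_biUnion_card_iff_exists_injective _).1 hall
  have hmem' : ∀ q, (h q).1 ∈ piece q := fun q => (mem_sigma.1 (hmem q)).1
  refine ⟨fun w => univ.image fun k => (h ⟨w, k⟩).1, fun w => ⟨?_, ?_⟩, fun x => ?_⟩
  · intro x hx
    simp only [mem_image, mem_univ, true_and] at hx
    obtain ⟨k, rfl⟩ := hx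
    exact hpT _ (hmem' _)
  · rw [card_image_of_injective]
    · simp
    · intro k k' hkk
      have h1 := hmem' ⟨w, k⟩
      have h2 := hmem' ⟨w, k'⟩
      dsimp only at hkk
      rw [hkk] at h1
      exact hpdisj w k k' _ h1 h2
  · have hex : ∀ w ∈ ({w | x ∈ univ.image fun k => (h ⟨w, k⟩).1} : Finset ι),
        ∃ q, q.1 = w ∧ (h q).1 = x := by
      intro w hw
      simp only [mem_filter, mem_univ, true_and, mem_image] at hw
      obtain ⟨k, hk⟩ := hw
      exact ⟨⟨w, k⟩, rfl, hk⟩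
    by_cases hne : Nonempty (Σ w, Fin (m w))
    · choose! q hq1 hq2 using hex
      calc _ ≤ #(({x} : Finset V).sigma fun x => (univ : Finset (Fin (cap x)))) := by
            apply card_le_card_of_injOn (fun w => h (q w))
            · intro w hw
              simpa using hq2 w hw
            · intro w hw w' hw' heq
              rw [← hq1 w hw, ← hq1 w' hw', hinj heq]
        _ = cap x := by simp
    · have : ({w | x ∈ univ.image fun k => (h ⟨w, k⟩).1} : Finset ι) = ∅ := by
        rw [eq_empty_iff_forall_notMem]
        intro w hw
        obtain ⟨q, -⟩ := hex w hw
        exact hne ⟨q⟩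
      rw [this]
      simp

/-- Vertices with sufficiently few neighbors can be recolored greedily so as to receive distinct
colors on prescribed small sets: it is enough to color the graph in which these sets are made
cliques. -/
lemma exists_injOn_recoloring {H : SimpleGraph V} {ψ : V → C} (hψ : H.ProperOff ∅ ψ)
    (R : ι → Finset V) {c : ℕ} (hR : ∀ w, #(R w) ≤ c)
    (hcap : ∀ w, ∀ x ∈ R w, H.degree x + (c - 1) * #{w | x ∈ R w} < Fintype.card C) :
    ∃ ψ' : V → C, H.ProperOff ∅ ψ' ∧ (∀ w, Set.InjOn ψ' (R w)) ∧
      ∀ v, (∀ w, v ∉ R w) → ψ' v = ψ v := by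
  obtain ⟨J, hJadj⟩ : ∃ J : SimpleGraph V,
      ∀ u v, J.Adj u v ↔ H.Adj u v ∨ u ≠ v ∧ ∃ w, u ∈ R w ∧ v ∈ R w := by
    refine ⟨H ⊔ SimpleGraph.fromRel fun u v => ∃ w, u ∈ R w ∧ v ∈ R w, fun u v => ?_⟩
    simp only [SimpleGraph.sup_adj, SimpleGraph.fromRel_adj]
    have : (∃ w, v ∈ R w ∧ u ∈ R w) ↔ ∃ w, u ∈ R w ∧ v ∈ R w :=
      exists_congr fun w => and_comm
    rw [this, or_self]
  set F : Finset V := univ.biUnion R with hF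
  have hFmem : ∀ v, v ∈ F ↔ ∃ w, v ∈ R w := by simp [hF]
  have h0 : J.ProperOff (∅ ∪ F) ψ := by
    intro u v huv hu hv
    rw [empty_union, hFmem] at hu hv
    rcases (hJadj u v).1 huv with h | ⟨-, w, h, -⟩
    · exact hψ h (notMem_empty _) (notMem_empty _)
    · exact absurd ⟨w, h⟩ hu
  obtain ⟨ψ', h1, h2⟩ := h0.fill_finset F (fun x hx => by
    obtain ⟨w₀, hw₀⟩ := (hFmem x).1 hx
    refine lt_of_le_of_lt ?_ (hcap w₀ x hw₀)
    have hsub : J.neighborFinset x ⊆ H.neighborFinset x ∪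
        ({w | x ∈ R w} : Finset ι).biUnion fun w => (R w).erase x := by
      intro u hu
      rw [SimpleGraph.mem_neighborFinset, hJadj] at hu
      simp only [mem_union, SimpleGraph.mem_neighborFinset, mem_biUnion, mem_filter, mem_univ,
        true_and, mem_erase]
      exact hu.imp id fun ⟨hne, w, hx, hu⟩ => ⟨w, hx, hne.symm, hu⟩
    rw [← J.card_neighborFinset_eq_degree, ← H.card_neighborFinset_eq_degree]
    refine (card_le_card hsub).trans ((card_union_le _ _).trans (Nat.add_le_add_left ?_ _))
    rw [mul_comm]
    apply card_biUnion_le_card_mul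
    intro w hw
    rw [card_erase_of_mem (by simpa using hw)]
    have := hR w
    omega)
  refine ⟨ψ', fun u v huv => h1 ((hJadj u v).2 (Or.inl huv)), fun w u hu v hv huv => ?_,
    fun v hv => h2 v (by simpa [hFmem] using hv)⟩
  by_contra hne
  exact h1 ((hJadj u v).2 (Or.inr ⟨hne, w, hu, hv⟩)) (notMem_empty _) (notMem_empty _) huv

end Selection

/-! ### Vertices of large degree see many colors -/

section Assembly

variable {V C I : Type*} [Fintype V] [Fintype C] [Fintype I] {G : SimpleGraph V} {pal : C → I}

/-- Dividing `D` colors into `c + 1` palettes of size `b = ⌈D / (c + 2)⌉` and a last one that is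
at most `c + 1` colors smaller. -/
lemma exists_palettes {D c : ℕ} (hD : (c ^ 3 + 8 * c ^ 2 + 19 * c + 6) * (c + 1) ≤ D) :
    ∃ (pal : Fin D → Fin (c + 2)) (b : ℕ), (∀ i, paletteSize pal i ≤ b) ∧
      c + 1 ≤ #{i | paletteSize pal i = b} ∧ ∀ i, 4 * c ^ 2 < paletteSize pal i + 3 := by
  set b := (D + c + 1) / (c + 2) with hb
  have hb1 : b * (c + 2) ≤ D + c + 1 := Nat.div_mul_le_self _ _
  have hb2 : D < b * (c + 2) + 1 := by
    have := Nat.lt_div_mul_add (a := D + c + 1) (b := c + 2) (by omega)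
    rw [← hb] at this
    omega
  have hb3 : 4 * c ^ 2 + c ≤ b + 1 := by
    by_contra! hcon
    have h1 : b * (c + 2) ≤ (4 * c ^ 2 + c) * (c + 2) := Nat.mul_le_mul_right _ (by omega)
    nlinarith [Nat.zero_le (c ^ 4), Nat.zero_le (c ^ 3), Nat.zero_le (c ^ 2)]
  have hb0 : 0 < b := by
    by_contra! hcon
    interval_cases b
    nlinarith [Nat.zero_le (c ^ 4), Nat.zero_le (c ^ 3), Nat.zero_le (c ^ 2)]
  have hlt : ∀ k : Fin D, k.1 / b < c + 2 := by
    intro k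
    rw [Nat.div_lt_iff_lt_mul hb0]
    have := k.2
    rw [mul_comm]
    omega
  have hsize : ∀ i : Fin (c + 2), paletteSize (fun k : Fin D => (⟨k.1 / b, hlt k⟩ : Fin (c + 2))) i =
      min ((i.1 + 1) * b) D - i.1 * b := by
    intro i
    rw [paletteSize, ← Nat.card_Ico, ← card_map Fin.valEmbedding]
    congr 1
    ext a
    simp only [mem_map, mem_filter, mem_univ, true_and, Fin.valEmbedding_apply, mem_Ico, Fin.ext_iff,
      lt_min_iff]
    constructor
    · rintro ⟨k, hk, rfl⟩
      rw [Nat.div_eq_iff hb0] at hk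
      have := k.2
      have e : (i.1 + 1) * b = i.1 * b + b := by ring
      omega
    · rintro ⟨h1, h2, h3⟩
      refine ⟨⟨a, h3⟩, ?_, rfl⟩
      rw [Nat.div_eq_iff hb0]
      have e : (i.1 + 1) * b = i.1 * b + b := by ring
      simp only
      omega
  have hfull : ∀ i : Fin (c + 2), i.1 ≤ c →
      paletteSize (fun k : Fin D => (⟨k.1 / b, hlt k⟩ : Fin (c + 2))) i = b := by
    intro i hi
    rw [hsize, min_eq_left]
    · rw [add_mul, one_mul, Nat.add_sub_cancel_left]
    · have h1 : (i.1 + 1) * b ≤ (c + 1) * b := Nat.mul_le_mul_right _ (by omega)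
      have h2 : b * (c + 2) = (c + 1) * b + b := by ring
      have : c + 1 ≤ b := by
        rcases Nat.eq_zero_or_pos c with rfl | hc
        · omega
        · nlinarith
      omega
  refine ⟨fun k => ⟨k.1 / b, hlt k⟩, b, fun i => ?_, ?_, fun i => ?_⟩
  · rw [hsize]
    have e : (i.1 + 1) * b = i.1 * b + b := by ring
    omega
  · calc c + 1 = #((univ : Finset (Fin (c + 1))).map Fin.castSuccEmb) := by simp
      _ ≤ _ := by
        apply card_le_card
        intro i hi
        simp only [mem_map, mem_univ, true_and] at hi
        obtain ⟨k, rfl⟩ := hi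
        simp only [mem_filter, mem_univ, true_and]
        apply hfull
        exact Nat.le_of_lt_succ k.2
  · by_cases hi : i.1 ≤ c
    · rw [hfull i hi]; omega
    · have hi' : i.1 = c + 1 := by omega
      rw [hsize, hi']
      have h1 : (c + 1 + 1) * b = b * (c + 2) := by ring
      have h2 : b * (c + 2) = (c + 1) * b + b := by ring
      rw [h1, min_eq_right (by omega)]
      omega

lemma mul_le_threshold {c q e : ℕ} (hc : 2 ≤ c) (hqe : q + e = c + 1) :
    q * ((2 * e + 1) * (2 * ((c + 2) * (c - 1)))) ≤
      (c ^ 3 + 8 * c ^ 2 + 19 * c + 6) * (c + 1) := by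
  have h1 : 8 * (q * (2 * e + 1)) ≤ (2 * c + 3) ^ 2 := by
    have : 2 * c + 3 = 2 * q + (2 * e + 1) := by omega
    rw [this]
    zify
    nlinarith [sq_nonneg (2 * (q : ℤ) - (2 * e + 1))]
  obtain ⟨k, rfl⟩ := Nat.exists_eq_add_of_le hc
  have e1 : 2 + k - 1 = k + 1 := by omega
  rw [e1]
  have h2 : 8 * (q * (2 * e + 1)) * (2 * ((2 + k + 2) * (k + 1))) ≤
      (2 * (2 + k) + 3) ^ 2 * (2 * ((2 + k + 2) * (k + 1))) := Nat.mul_le_mul_right _ h1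
  nlinarith [Nat.zero_le (k ^ 4), Nat.zero_le (k ^ 3), Nat.zero_le (k ^ 2)]

/-- The spare colors at `x`: the size of the palette of its part minus the number of neighbors in
this part. -/
noncomputable def spare (G : SimpleGraph V) (pal : C → I) (φ : V → C) (x : V) : ℕ :=
  paletteSize pal (pal (φ x)) - partDegree G (pal ∘ φ) (pal (φ x)) x

/-- The subgraph of the edges with both ends in the part `j`. -/
def partGraph (G : SimpleGraph V) (f : V → I) (j : I) : SimpleGraph V where
  Adj u v := G.Adj u v ∧ f u = j ∧ f v = j
  symm := ⟨fun _ _ h => ⟨h.1.symm, h.2.2, h.2.1⟩⟩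
  loopless := ⟨fun _ h => h.1.ne rfl⟩

lemma degree_partGraph_le (f : V → I) (j : I) (v : V) :
    (partGraph G f j).degree v ≤ partDegree G f j v := by
  rw [← SimpleGraph.card_neighborFinset_eq_degree]
  apply card_le_card
  intro u hu
  rw [SimpleGraph.mem_neighborFinset] at hu
  simpa using ⟨hu.1, hu.2.2⟩

lemma degree_partGraph_eq_zero {f : V → I} {j : I} {v : V} (hv : f v ≠ j) :
    (partGraph G f j).degree v = 0 := by
  rw [← SimpleGraph.card_neighborFinset_eq_degree, card_eq_zero, eq_empty_iff_forall_notMem]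
  intro u hu
  rw [SimpleGraph.mem_neighborFinset] at hu
  exact hv hu.2.1

/-- Recoloring one part: the sets `P w` of vertices with few spare colors are handled by
`exists_rainbow_representatives`, and afterwards the sets `R w` of vertices with many spare colors
are recolored greedily. -/
lemma exists_part_coloring {φ : V → C} {c : ℕ} (hc : 2 ≤ c) (hφ : G.ProperOff ∅ φ)
    (hle : ∀ x, partDegree G (pal ∘ φ) (pal (φ x)) x ≤ paletteSize pal (pal (φ x))) (j : I)
    (hsize : 4 * c ^ 2 < paletteSize pal j + 3) {ι ι' : Type*} [Fintype ι] [Fintype ι']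
    (e : ι → ℕ) (he : ∀ w, e w ≤ c) (P : ι → Finset V) (hPcard : ∀ w, 2 * e w + 1 ≤ #(P w))
    (hPdisj : ∀ x, #{w | x ∈ P w} ≤ 1)
    (hP : ∀ w, ∀ x ∈ P w, pal (φ x) = j ∧ 1 ≤ spare G pal φ x ∧ spare G pal φ x < c)
    (R : ι' → Finset V) (hRcard : ∀ w, #(R w) ≤ c)
    (hRcap : ∀ x, #{w | x ∈ R w} ≤ (spare G pal φ x - 1) / (c - 1))
    (hR : ∀ w, ∀ x ∈ R w, pal (φ x) = j ∧ c ≤ spare G pal φ x) :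
    ∃ ψ : V → {k // pal k = j},
      (∀ u v, G.Adj u v → pal (φ u) = j → pal (φ v) = j → ψ u ≠ ψ v) ∧
      (∀ w, ∃ Q ⊆ P w, #Q = e w ∧ Set.InjOn ψ Q) ∧ ∀ w, Set.InjOn ψ (R w) := by
  have hcard : Fintype.card {k // pal k = j} = paletteSize pal j := Fintype.card_subtype _
  have hdegle : ∀ v, pal (φ v) = j →
      (partGraph G (pal ∘ φ) j).degree v + spare G pal φ v ≤ Fintype.card {k // pal k = j} := by
    intro v hv
    have h1 := degree_partGraph_le (G := G) (pal ∘ φ) j v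
    have h2 := hle v
    rw [spare, hcard]
    rw [hv] at h2 ⊢
    omega
  have hdeg : ∀ v, (partGraph G (pal ∘ φ) j).degree v ≤ Fintype.card {k // pal k = j} := by
    intro v
    by_cases hv : pal (φ v) = j
    · exact (Nat.le_add_right _ _).trans (hdegle v hv)
    · rw [degree_partGraph_eq_zero (f := pal ∘ φ) hv]; exact Nat.zero_le _
  obtain ⟨k₀⟩ : Nonempty {k // pal k = j} := by
    rw [← Fintype.card_pos_iff, hcard]; nlinarith
  have h0 : (partGraph G (pal ∘ φ) j).ProperOff ∅
      (fun v => if h : pal (φ v) = j then (⟨φ v, h⟩ : {k // pal k = j}) else k₀) := by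
    intro u v huv hu hv
    have h1 : pal (φ u) = j := huv.2.1
    have h2 : pal (φ v) = j := huv.2.2
    simp only [h1, h2, dif_pos, ne_eq, Subtype.mk.injEq]
    exact hφ huv.1 hu hv
  obtain ⟨ψ, Q, h1, h2⟩ := exists_rainbow_representatives (P := P) (e := e) (c := c) (by omega)
    (by rwa [hcard]) hdeg
    (fun w v hv => by
      have h3 := hP w v hv
      have h4 := hdegle v h3.1
      omega)
    (fun w w' v hv hv' => card_le_one.1 (hPdisj v) w (by simpa using hv) w' (by simpa using hv'))
    he hPcard h0
  obtain ⟨ψ', h3, h4, h5⟩ := exists_injOn_recoloring h1 R hRcard (fun w x hx => by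
    obtain ⟨h6, h7⟩ := hR w x hx
    have h8 := hdegle x h6
    have h9 : (c - 1) * #{w | x ∈ R w} ≤ spare G pal φ x - 1 :=
      (Nat.mul_le_mul_left _ (hRcap x)).trans (Nat.mul_div_le _ _)
    omega)
  refine ⟨ψ', fun u v huv hu hv => h3 (show (partGraph G (pal ∘ φ) j).Adj u v from ⟨huv, hu, hv⟩)
    (notMem_empty _) (notMem_empty _), fun w => ⟨Q w, (h2 w).1, (h2 w).2.1, ?_⟩, h4⟩
  have hkeep : ∀ x ∈ Q w, ψ' x = ψ x := by
    intro x hx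
    apply h5
    intro w' hx'
    have h6 := hP w x ((h2 w).1 hx)
    have h7 := hR w' x hx'
    omega
  intro u hu v hv huv
  rw [hkeep u hu, hkeep v hv] at huv
  exact (h2 w).2.2 hu hv huv

/-- A vertex of large degree that sees few parts has many neighbors in one of them. -/
lemma exists_large_part {f : V → I} {c p : ℕ} (hp : 0 < p)
    (hpc : ∀ q e, q + e = c + 1 → q * ((2 * e + 1) * (2 * ((c + 2) * (c - 1)))) ≤ p) {w : V}
    (hw : p ≤ G.degree w) (hwc : #(seenParts G f w) < c) :
    ∃ j ∈ seenParts G f w, (2 * (c + 1 - #(seenParts G f w)) + 1) * (2 * ((c + 2) * (c - 1))) ≤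
      partDegree G f j w := by
  have hsum : ∑ i ∈ seenParts G f w, partDegree G f i w = G.degree w := by
    rw [← sum_partDegree f w]
    exact sum_subset (subset_univ _) fun i _ hi => partDegree_eq_zero hi
  have hne : (seenParts G f w).Nonempty := by
    rw [nonempty_iff_ne_empty]
    intro h
    rw [h, sum_empty] at hsum
    omega
  apply exists_le_of_sum_le hne
  rw [hsum, sum_const, smul_eq_mul]
  exact (hpc _ _ (by omega)).trans hw

/-- Call `S w` poor if about half of its elements `x` have `s x < c`. The poor sets contain
pairwise disjoint sets of `2 e w + 1` such elements, and the others contain sets of `e w` elements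
with `c ≤ s x` that do not overlap too much. -/
lemma exists_poor_or_rich_subsets {ι : Type*} [Fintype ι] (S : ι → Finset V) (s : V → ℕ)
    (e : ι → ℕ) {c : ℕ} (hc : 2 ≤ c)
    (hS : ∀ w, (2 * e w + 1) * (2 * ((c + 2) * (c - 1))) ≤ #(S w))
    (hcount : ∀ x, #{w | x ∈ S w} ≤ (c + 2) * s x) :
    ∃ (poor : ι → Prop) (P R : ι → Finset V),
      (∀ w, poor w → (∀ x ∈ P w, x ∈ S w ∧ s x < c) ∧ #(P w) = 2 * e w + 1) ∧
      (∀ w, ¬ poor w → (∀ x ∈ R w, x ∈ S w ∧ c ≤ s x) ∧ #(R w) = e w) ∧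
      (∀ x, #{w | x ∈ P w} ≤ 1) ∧ ∀ x, #{w | x ∈ R w} ≤ (s x - 1) / (c - 1) := by
  set κ := (c + 2) * (c - 1) with hκ
  have hκpos : 0 < κ := Nat.mul_pos (by omega) (by omega)
  obtain ⟨poor, hpoor⟩ : ∃ poor : ι → Prop,
      ∀ w, poor w ↔ (2 * e w + 1) * κ ≤ #{x ∈ S w | s x < c} := ⟨_, fun _ => Iff.rfl⟩
  have hrich : ∀ w, ¬ poor w → e w * (2 * κ) ≤ #{x ∈ S w | ¬ s x < c} := by
    intro w hw
    have h1 := hS w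
    rw [← card_filter_add_card_filter_not (s := S w) (fun x => s x < c)] at h1
    rw [hpoor, not_le] at hw
    nlinarith
  obtain ⟨P, hP, hPcap⟩ := exists_capped_subsets
    (fun w => {x ∈ S w | s x < c ∧ poor w}) (fun w => if poor w then 2 * e w + 1 else 0)
    (fun _ => 1) hκpos (fun w => by
      by_cases hw : poor w
      · simpa [hw] using (hpoor w).1 hw
      · simp [hw]) (fun x => by
      by_cases hx : s x < c
      · have h1 : #{w | x ∈ ({x ∈ S w | s x < c ∧ poor w} : Finset V)} ≤ #{w | x ∈ S w} :=
          card_le_card fun w hw => by simp at hw; simpa using hw.1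
        have h2 : (c + 2) * s x ≤ (c + 2) * (c - 1) := Nat.mul_le_mul_left _ (by omega)
        rw [mul_one]
        exact h1.trans ((hcount x).trans h2)
      · simp [hx])
  obtain ⟨R, hR, hRcap⟩ := exists_capped_subsets
    (fun w => {x ∈ S w | ¬ s x < c ∧ ¬ poor w}) (fun w => if poor w then 0 else e w)
    (fun x => (s x - 1) / (c - 1)) (K := 2 * κ) (by omega) (fun w => by
      by_cases hw : poor w
      · simp [hw]
      · simpa [hw] using hrich w hw) (fun x => by
      by_cases hx : s x < c
      · simp [not_le.2 hx]
      · have h1 : #{w | x ∈ ({x ∈ S w | ¬ s x < c ∧ ¬ poor w} : Finset V)} ≤ #{w | x ∈ S w} :=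
          card_le_card fun w hw => by simp at hw; simpa using hw.1
        have h2 : (c + 2) * s x ≤ (c + 2) * ((c - 1) * (2 * ((s x - 1) / (c - 1)))) := by
          apply Nat.mul_le_mul_left
          have h3 : 1 ≤ (s x - 1) / (c - 1) := (Nat.one_le_div_iff (by omega)).2 (by omega)
          have h4 := Nat.lt_div_mul_add (a := s x - 1) (b := c - 1) (by omega)
          have h5 := Nat.mul_le_mul_right (c - 1) h3
          have h6 : (c - 1) * (2 * ((s x - 1) / (c - 1))) = 2 * ((s x - 1) / (c - 1) * (c - 1)) := by
            ring
          omega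
        refine h1.trans ((hcount x).trans (h2.trans_eq ?_))
        rw [hκ]
        ring)
  refine ⟨poor, P, R, fun w hw => ⟨fun x hx => ?_, ?_⟩, fun w hw => ⟨fun x hx => ?_, ?_⟩,
    hPcap, hRcap⟩
  · have := mem_filter.1 ((hP w).1 hx)
    exact ⟨this.1, this.2.1⟩
  · rw [(hP w).2, if_pos hw]
  · have := mem_filter.1 ((hR w).1 hx)
    exact ⟨this.1, not_lt.1 this.2.1⟩
  · rw [(hR w).2, if_neg hw]

/-- Without changing the vertex partition, a coloring of least energy can be turned into one in which
every vertex of degree at least `p` sees `c` colors. -/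
theorem IsMinEnergyColoring.exists_many_colors {φ : V → C} (h : IsMinEnergyColoring G pal φ)
    {b c p : ℕ} (hc : 2 ≤ c) (hI : Fintype.card I = c + 2)
    (hdeg : ∀ v, G.degree v ≤ Fintype.card C)
    (hb : ∀ i, paletteSize pal i ≤ b) (hbig : c + 1 ≤ #{i | paletteSize pal i = b})
    (hsize : ∀ i, 4 * c ^ 2 < paletteSize pal i + 3) (hp : 0 < p)
    (hpc : ∀ q e, q + e = c + 1 → q * ((2 * e + 1) * (2 * ((c + 2) * (c - 1)))) ≤ p) :
    ∃ ξ : V → C, G.ProperOff ∅ ξ ∧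
      ∀ w, p ≤ G.degree w → c ≤ #((G.neighborFinset w).image ξ) := by
  have hpos : ∀ i, 0 < paletteSize pal i := fun i => by have := hsize i; nlinarith
  have hle := h.partDegree_le hdeg
  set κ := (c + 2) * (c - 1) with hκ
  have hκpos : 0 < κ := Nat.mul_pos (by omega) (by omega)
  have hspare : ∀ x, #{w | G.Adj x w ∧ #(seenParts G (pal ∘ φ) w) < c} ≤
      (c + 2) * spare G pal φ x := by
    intro x
    have h1 := h.card_add_mul_le hdeg hpos hb hbig x
    rw [hI] at h1
    rw [spare, Nat.mul_sub]
    omega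
  let ι := {w : V // p ≤ G.degree w ∧ #(seenParts G (pal ∘ φ) w) < c}
  have hlarge := fun w : ι => exists_large_part hp hpc w.2.1 w.2.2
  choose part hpart hlarge using hlarge
  set e : ι → ℕ := fun w => c + 1 - #(seenParts G (pal ∘ φ) w.1) with he
  have hec : ∀ w, e w ≤ c := fun w => by
    have : 0 < #(seenParts G (pal ∘ φ) w.1) := card_pos.2 ⟨_, hpart w⟩
    simp only [he]
    omega
  set S : ι → Finset V := fun w => {x | G.Adj w.1 x ∧ pal (φ x) = part w} with hS
  have hSmem : ∀ w x, x ∈ S w ↔ G.Adj w.1 x ∧ pal (φ x) = part w := by intro w x; simp [hS]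
  have hScard : ∀ w, (2 * e w + 1) * (2 * κ) ≤ #(S w) := hlarge
  -- each vertex lies in few of the sets `S w`
  have hcount : ∀ x, #{w | x ∈ S w} ≤ (c + 2) * spare G pal φ x := by
    intro x
    refine le_trans ?_ (hspare x)
    apply card_le_card_of_injOn Subtype.val
    · intro w hw
      rw [mem_coe, mem_filter, hSmem] at hw
      simpa using ⟨hw.2.1.symm, w.2.2⟩
    · exact Subtype.val_injective.injOn
  have hspos : ∀ w, ∀ x ∈ S w, 1 ≤ spare G pal φ x := by
    intro w x hx
    have h1 := hspare x
    have h2 : 0 < #{w | G.Adj x w ∧ #(seenParts G (pal ∘ φ) w) < c} :=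
      card_pos.2 ⟨w.1, by simpa using ⟨((hSmem w x).1 hx).1.symm, w.2.2⟩⟩
    by_contra hcon
    have h3 : spare G pal φ x = 0 := by omega
    rw [h3] at h1
    omega
  obtain ⟨poor, P, R, hP, hR, hPcap, hRcap⟩ :=
    exists_poor_or_rich_subsets S (spare G pal φ) e hc hScard hcount
  have hparts : ∀ j, ∃ ψ : V → {k // pal k = j},
      (∀ u v, G.Adj u v → pal (φ u) = j → pal (φ v) = j → ψ u ≠ ψ v) ∧
      ∀ w, part w = j → ∃ Q ⊆ S w, #Q = e w ∧ Set.InjOn ψ Q := by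
    intro j
    have hinj : ∀ (q : ι → Prop) [Fintype {w // q w}] (T : ι → Finset V) (x : V),
        #{w : {w // q w} | x ∈ T w.1} ≤ #{w | x ∈ T w} := by
      intro q _ T x
      apply card_le_card_of_injOn Subtype.val
      · intro w hw; simpa using hw
      · exact Subtype.val_injective.injOn
    obtain ⟨ψ, h1, h2, h3⟩ := exists_part_coloring hc h.proper hle j (hsize j)
      (ι := {w // poor w ∧ part w = j}) (ι' := {w // ¬ poor w ∧ part w = j})
      (fun w => e w.1) (fun w => hec _) (fun w => P w.1) (fun w => (hP w.1 w.2.1).2.ge)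
      (fun x => (hinj _ P x).trans (hPcap x))
      (fun w x hx => by
        obtain ⟨h4, h5⟩ := (hP w.1 w.2.1).1 x hx
        exact ⟨((hSmem _ _).1 h4).2.trans w.2.2, hspos _ x h4, h5⟩)
      (fun w => R w.1) (fun w => (hR w.1 w.2.1).2.le.trans (hec _))
      (fun x => (hinj _ R x).trans (hRcap x))
      (fun w x hx => by
        obtain ⟨h4, h5⟩ := (hR w.1 w.2.1).1 x hx
        exact ⟨((hSmem _ _).1 h4).2.trans w.2.2, h5⟩)
    refine ⟨ψ, h1, fun w hw => ?_⟩
    by_cases hpw : poor w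
    · obtain ⟨Q, h4, h5, h6⟩ := h2 ⟨w, hpw, hw⟩
      exact ⟨Q, fun x hx => ((hP w hpw).1 x (h4 hx)).1, h5, h6⟩
    · exact ⟨R w, fun x hx => ((hR w hpw).1 x hx).1, (hR w hpw).2, h3 ⟨w, hpw, hw⟩⟩
  choose ψ hψ hψQ using hparts
  have hpal : ∀ x, pal (ψ (pal (φ x)) x).1 = pal (φ x) := fun x => (ψ (pal (φ x)) x).2
  have hξ : ∀ x i, pal (φ x) = i → (ψ (pal (φ x)) x).1 = (ψ i x).1 := by
    rintro x _ rfl; rfl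
  refine ⟨fun x => (ψ (pal (φ x)) x).1, fun u v huv _ _ heq => ?_, fun w hw => ?_⟩
  · dsimp only at heq
    have h1 : pal (φ u) = pal (φ v) := by rw [← hpal u, ← hpal v, heq]
    refine hψ _ u v huv h1 rfl (Subtype.ext ?_)
    rw [← heq, hξ u _ h1]
  · set A := (G.neighborFinset w).image fun x => (ψ (pal (φ x)) x).1 with hA
    have hseen : seenParts G (pal ∘ φ) w = A.image pal := by
      rw [hA, image_image, seenParts]
      exact image_congr fun x _ => (hpal x).symm
    by_cases hwc : #(seenParts G (pal ∘ φ) w) < c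
    · obtain ⟨Q, hQS, hQe, hQinj⟩ := hψQ _ ⟨w, hw, hwc⟩ rfl
      set j := part ⟨w, hw, hwc⟩ with hj
      have hQj : ∀ x ∈ Q, G.Adj w x ∧ pal (φ x) = j := fun x hx => (hSmem _ x).1 (hQS hx)
      -- the colors of `Q` lie in the palette of `j`
      have h1 : #Q ≤ #{k ∈ A | pal k = j} := by
        apply card_le_card_of_injOn (fun x => (ψ (pal (φ x)) x).1)
        · intro x hx
          obtain ⟨hwx, hxj⟩ := hQj x hx
          rw [mem_coe, mem_filter, hpal, hA]
          exact ⟨mem_image_of_mem _ (by simpa using hwx), hxj⟩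
        · intro x hx y hy hxy
          dsimp only at hxy
          rw [hξ x j (hQj x hx).2, hξ y j (hQj y hy).2] at hxy
          exact hQinj hx hy (Subtype.ext hxy)
      have h2 : #((seenParts G (pal ∘ φ) w).erase j) ≤ #{k ∈ A | ¬ pal k = j} := by
        refine le_trans (card_le_card ?_) (card_image_le (f := pal))
        intro i hi
        rw [hseen, mem_erase, mem_image] at hi
        obtain ⟨hij, k, hk, rfl⟩ := hi
        exact mem_image_of_mem _ (mem_filter.2 ⟨hk, hij⟩)
      have hjS : j ∈ seenParts G (pal ∘ φ) w := hpart ⟨w, hw, hwc⟩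
      rw [card_erase_of_mem hjS] at h2
      have h3 := card_filter_add_card_filter_not (s := A) (fun k => pal k = j)
      simp only [he] at hQe
      omega
    · rw [hseen] at hwc
      exact (not_lt.1 hwc).trans card_image_le

end Assembly

end NondegenerateColoring

theorem theorem1 {V : Type*} [Fintype V] (G : SimpleGraph V) [DecidableRel G.Adj]
    (D : ℕ) (hD : 3 ≤ D) (hclique : G.CliqueFree (D + 1)) (hdeg : G.maxDegree ≤ D)
    (c : ℕ) (hc : 2 ≤ c) :
    ∃ ξ : G.Coloring (Fin D),
      G.IsNondegenerateColoring c ((c ^ 3 + 8 * c ^ 2 + 19 * c + 6) * (c + 1)) ξ := by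
  classical
  have hdeg' : ∀ v, G.degree v ≤ Fintype.card (Fin D) := fun v => by
    rw [Fintype.card_fin]; exact (G.degree_le_maxDegree v).trans hdeg
  have hB := exists_properOff_compl (C := Fin D) (H := G) (fun v => by convert hdeg' v)
    (by simpa using hD) (by simpa using hclique) Finset.univ
  obtain ⟨φ₀, hφ₀⟩ := hB
  rw [Finset.compl_univ] at hφ₀
  by_cases hp : (c ^ 3 + 8 * c ^ 2 + 19 * c + 6) * (c + 1) ≤ D
  · obtain ⟨pal, b, hb, hbig, hsize⟩ := exists_palettes hp
    obtain ⟨φ, hφ⟩ := exists_isMinEnergyColoring pal hφ₀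
    obtain ⟨ξ, h1, h2⟩ := hφ.exists_many_colors hc (by simp) (fun v => by convert hdeg' v) hb hbig
      hsize (by positivity) (fun q e => mul_le_threshold hc)
    refine ⟨⟨ξ, fun {u v} huv => h1 huv (Finset.notMem_empty _) (Finset.notMem_empty _)⟩, fun v hv => ?_⟩
    have h3 := h2 v (by convert hv)
    have h4 : (ξ '' G.neighborSet v) = ((G.neighborFinset v).image ξ : Finset (Fin D)) := by
      simp
    change c ≤ (ξ '' G.neighborSet v).ncard
    rw [h4, Set.ncard_coe_finset]
    convert h3
  · refine ⟨⟨φ₀, fun {u v} huv => hφ₀ huv (Finset.notMem_empty _) (Finset.notMem_empty _)⟩, fun v hv => ?_⟩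
    have := hdeg' v
    rw [Fintype.card_fin] at this
    omega
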